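/- For a compact convex set $K\subset\mathbb R^2$ with nonempty interior and $p>0$, let $$h_{p,K}(y)=\log\Big(\int_K e^{p\langle x,y\rangle}\,\frac{dx}{|K|}\Big)^{1/p},\qquad \mathcal M_p(K)=|K|\int_{\mathbb R^2}e^{-h_{p,K}(y)}\,dy ,$$ where $|K|$ is the area of $K$. Let $S\subset\mathbb R^2$ be a convex polygon, symmetric about the origin ($S=-S$). For a vertex $v$ of $S$ with neighbouring vertices $u\neq w$, and for $s\in\mathbb R$, let $S_{v}(s)$ be the convex hull of the two points $\pm(v+s(w-u))$ and of all vertices of $S$ other than $\pm v$. A set $S'$ is said to be obtained from $S$ by symmetric Mahler sliding if $S'=S_{v}(t)$ for some such $v,u,w$ and some $t\in\mathbb R$ with $|S_{v}(s)|=|S|$ for all $s$ between $0$ and $t$ (the antipodal vertices $\pm v$ are moved parallel to the chord $[u,w]$ joining the neighbours of $v$, and the area is constant throughout the motion). Proposition. Let $p>0$ and let $S\subset\mathbb R^2$ be an origin-symmetric convex polygon with exactly $2m>4$ vertices. Then there is an origin-symmetric convex polygon $S'$ with exactly $2m-2$ vertices, obtained from $S$ by symmetric Mahler sliding, such that $$\mathcal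 M_p(S')\le \mathcal M_p(S).$$ -/

import Mathlib

open MeasureTheory

/-- The Euclidean plane `ℝ²`. -/
abbrev Plane : Type := EuclideanSpace ℝ (Fin 2)

/-- The `L^p`-support function
`h_{p,K}(y) = log ((∫_K e^{p⟨x,y⟩} dx / |K|)^{1/p})`. -/
noncomputable def lpSupport (p : ℝ) (K : Set Plane) (y : Plane) : ℝ :=
  Real.log (((∫ x in K, Real.exp (p * inner ℝ x y)) / volume.real K) ^ (1 / p))

/-- The `L^p`-Mahler volume `M_p(K) = |K| ∫_{ℝ²} e^{-h_{p,K}(y)} dy`, with values in `[0, ∞]`. -/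
noncomputable def lpMahlerVolume (p : ℝ) (K : Set Plane) : ENNReal :=
  volume K * ∫⁻ y : Plane, ENNReal.ofReal (Real.exp (-lpSupport p K y))

/-- `S` is a polytope symmetric about the origin with exactly `k` vertices
(the vertices of a polytope are its extreme points). -/
def IsSymmetricPolygon (S : Set Plane) (k : ℕ) : Prop :=
  (∃ F : Finset Plane, S = convexHull ℝ (F : Set Plane)) ∧
    (∀ x ∈ S, -x ∈ S) ∧ (S.extremePoints ℝ).ncard = k

/-- `[u, v]` is an edge of `S`, that is, a nondegenerate segment that is a face of `S`.
(The endpoints `u`, `v` are then vertices of `S`.) -/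
def IsEdge (S : Set Plane) (u v : Plane) : Prop :=
  u ≠ v ∧ IsExtreme ℝ S (segment ℝ u v)

/-- Symmetric sliding of the vertices `±v` of `S` parallel to the direction `d`: the convex hull
of all vertices of `S` other than `v`, `-v`, together with the displaced points `±(v + t d)`. -/
def slide (S : Set Plane) (v d : Plane) (t : ℝ) : Set Plane :=
  convexHull ℝ ((S.extremePoints ℝ \ {v, -v}) ∪ {v + t • d, -(v + t • d)})

/-- `S'` is obtained from `S` by symmetric Mahler sliding: for some vertex `v` of `S` with its two
neighbouring vertices `u`, `w`, the antipodal vertices `±v` are moved to `±(v + t (w - u))`, the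
other vertices being kept fixed, and the area stays constant throughout the motion. -/
def IsMahlerSliding (S S' : Set Plane) : Prop :=
  ∃ (u v w : Plane) (t : ℝ), u ≠ w ∧ IsEdge S u v ∧ IsEdge S v w ∧
    (∀ s ∈ Set.uIcc 0 t, volume (slide S v (w - u) s) = volume S) ∧
    S' = slide S v (w - u) t

/-! Take a vertex v with neighbours u and w, and slide ±v along d = w - u in both senses, until v
meets the line carrying the next edge beyond w, respectively beyond u. At that moment w,
respectively u, falls inside an edge and stops being a vertex; the antipode does the same, so
exactly two vertices are lost. It remains to see that at least one of the two final polygons has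
`lpMahlerVolume` at most that of S.

The motion is an odd shear x ↦ x + tφ(l x)d. Here l is the functional equal to 1 on the chord [u,
w], and φ (`slideProfile`) vanishes on the middle strip |l| ≤ 1 and is affine on each of the two
triangular caps. Shears preserve area, hence the area condition. Choose y₁, y₂ with ⟨d, y₁⟩ = 1 and
⟨d, y₂⟩ = 0. At y = a y₁ + b y₂ the integrand exp(-h) of the polygon at time t equals E(a, b, ta),
where E(a, b, c) is the power -1/p of the mean over S of exp(p(a⟨x, y₁⟩ + b⟨x, y₂⟩ + cφ(l x))). The
function E does not depend on t; it is log-concave by Hölder and even by symmetry. So, up to a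
constant factor, the functional at time t is the integral of E over the plane c = ta, and all these
planes contain the b-axis.

A Busemann-type argument (`min_lintegral_slope_le`) bounds the integral at slope 0 below by the
smaller of those at a negative and a positive slope: integrate out b by Prékopa–Leindler, invert a =
1/x, and apply the harmonic-mean case of Borell–Brascamp–Lieb (`min_integral_le_of_harmonic`). This
yields `min_lpMahlerVolume_le`, which is applied to the two extreme times. -/

/-! ### One-dimensional inequalities of Brunn–Minkowski type -/

/-- The one-dimensional Brunn–Minkowski inequality for compact sets. -/
theorem volume_add_volume_le_of_isCompact {A B C : Set ℝ} (hA : IsCompact A) (hB : IsCompact B)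
    (hAn : A.Nonempty) (hBn : B.Nonempty) (h : ∀ a ∈ A, ∀ b ∈ B, a + b ∈ C) :
    volume A + volume B ≤ volume C := by
  obtain ⟨a, haA, ha⟩ := hA.exists_isGreatest hAn
  obtain ⟨b, hbB, hb⟩ := hB.exists_isLeast hBn
  have h1 : volume ((fun x => b + x) '' A) = volume A := by simp
  have h2 : volume ((fun x => a + x) '' B) = volume B := by simp
  have hmB : MeasurableSet ((fun x => a + x) '' B) :=
    (hB.image (by fun_prop)).measurableSet
  -- Translated by min B and max A respectively, the two sets lie on opposite sides of max A + min
  -- B.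
  have hint : AEDisjoint volume ((fun x => b + x) '' A) ((fun x => a + x) '' B) := by
    refine measure_mono_null (t := {a + b}) ?_ (by simp)
    rintro x ⟨⟨y, hy, rfl⟩, ⟨z, hz, hzy⟩⟩
    have := ha hy
    have := hb hz
    simp only [Set.mem_singleton_iff] at *
    linarith
  rw [← h1, ← h2, ← measure_union₀ hmB.nullMeasurableSet hint]
  refine measure_mono ?_
  rintro x (⟨y, hy, rfl⟩ | ⟨y, hy, rfl⟩)
  · simpa [add_comm] using h y hy b hbB
  · exact h a haA y hy

/-- The one-dimensional Brunn–Minkowski inequality. -/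
theorem volume_add_volume_le {A B C : Set ℝ} (hA : MeasurableSet A) (hB : MeasurableSet B)
    (hAn : A.Nonempty) (hBn : B.Nonempty) (h : ∀ a ∈ A, ∀ b ∈ B, a + b ∈ C) :
    volume A + volume B ≤ volume C := by
  obtain ⟨a, ha⟩ := hAn
  obtain ⟨b, hb⟩ := hBn
  have key : ∀ K ⊆ A, IsCompact K → ∀ L ⊆ B, IsCompact L → volume K + volume L ≤ volume C := by
    intro K hKA hK L hLB hL
    -- Adjoining the points a and b keeps both compact sets nonempty, so `K` and `L` may be empty
    -- here.
    refine (add_le_add (measure_mono Set.subset_union_left)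
      (measure_mono Set.subset_union_left)).trans
      (volume_add_volume_le_of_isCompact (hK.union (isCompact_singleton (x := a)))
        (hL.union (isCompact_singleton (x := b))) (by simp) (by simp) fun x hx y hy => ?_)
    refine h x ?_ y ?_
    · rcases hx with hx | rfl
      exacts [hKA hx, ha]
    · rcases hy with hy | rfl
      exacts [hLB hy, hb]
  by_cases hC : volume C = ⊤
  · simp [hC]
  have fin : ∀ {x y : ENNReal}, x + y ≤ volume C → y ≠ ⊤ := fun hxy =>
    ne_top_of_le_ne_top hC (le_add_self.trans hxy)
  have fin' : ∀ {x y : ENNReal}, x + y ≤ volume C → x ≠ ⊤ := fun hxy =>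
    ne_top_of_le_ne_top hC (le_self_add.trans hxy)
  have step : ∀ K ⊆ A, IsCompact K → volume K + volume B ≤ volume C := by
    intro K hKA hK
    have h0 := key K hKA hK ∅ (Set.empty_subset _) isCompact_empty
    have : volume B ≤ volume C - volume K := by
      rw [hB.measure_eq_iSup_isCompact]
      exact iSup_le fun L => iSup_le fun hLB => iSup_le fun hL =>
        ENNReal.le_sub_of_add_le_left (fin' h0) (key K hKA hK L hLB hL)
    exact (add_le_add_right this _).trans
      (add_tsub_cancel_of_le (le_self_add.trans h0)).le
  have h0 := step ∅ (Set.empty_subset _) isCompact_empty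
  have : volume A ≤ volume C - volume B := by
    rw [hA.measure_eq_iSup_isCompact]
    exact iSup_le fun K => iSup_le fun hKA => iSup_le fun hK =>
      ENNReal.le_sub_of_add_le_right (fin h0) (step K hKA hK)
  exact (add_le_add_left this _).trans (tsub_add_cancel_of_le (le_add_self.trans h0)).le

/-- If `f` and `g` have supremum `1` and the superlevel sets of `h` contain the convex combinations
of those of `f` and `g`, then `∫ h` is at least the convex combination of `∫ f` and `∫ g`. -/
theorem convex_comb_lintegral_le {f g h : ℝ → ℝ} {μ ν : ℝ} (hμ : 0 < μ) (hν : 0 < ν)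
    (hfm : Measurable f) (hgm : Measurable g) (hhm : Measurable h)
    (hf0 : ∀ x, 0 ≤ f x) (hg0 : ∀ x, 0 ≤ g x) (hh0 : ∀ x, 0 ≤ h x)
    (hf1 : ∀ x, f x ≤ 1) (hg1 : ∀ x, g x ≤ 1)
    (hfs : ∀ c < 1, ∃ x, c < f x) (hgs : ∀ c < 1, ∃ x, c < g x)
    (H : ∀ x y c, 0 < c → c < f x → c < g y → c < h (μ * x + ν * y)) :
    ENNReal.ofReal μ * (∫⁻ x, ENNReal.ofReal (f x)) +
      ENNReal.ofReal ν * (∫⁻ x, ENNReal.ofReal (g x))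
      ≤ ∫⁻ x, ENNReal.ofReal (h x) := by
  have layer : ∀ {φ : ℝ → ℝ}, Measurable φ → (∀ x, 0 ≤ φ x) → (∀ x, φ x ≤ 1) →
      ∫⁻ x, ENNReal.ofReal (φ x) = ∫⁻ t in Set.Ioo 0 1, volume {x | t < φ x} := by
    intro φ hm h0 h1
    rw [lintegral_eq_lintegral_meas_lt _ (Filter.Eventually.of_forall h0) hm.aemeasurable,
      ← Set.Ioo_union_Ici_eq_Ioi (zero_lt_one (α := ℝ)),
      lintegral_union measurableSet_Ici (by
        rw [Set.disjoint_left]; rintro x ⟨_, hx⟩ hx'; exact absurd hx' (not_le.2 hx))]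
    have : ∫⁻ t in Set.Ici (1 : ℝ), volume {x | t < φ x} = 0 := by
      rw [setLIntegral_congr_fun (g := fun _ => 0) measurableSet_Ici]
      · simp
      · intro t ht
        have : {x | t < φ x} = ∅ := by
          ext x; simpa using (h1 x).trans ht
        simp [this]
    rw [this, add_zero]
  have hmeas : ∀ φ : ℝ → ℝ, Measurable fun t : ℝ => volume {x | t < φ x} := fun φ =>
    Antitone.measurable fun s t hst => measure_mono fun x (hx : t < φ x) => lt_of_le_of_lt hst hx
  rw [layer hfm hf0 hf1, layer hgm hg0 hg1, lintegral_eq_lintegral_meas_lt _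
    (Filter.Eventually.of_forall hh0) hhm.aemeasurable, ← lintegral_const_mul _ (hmeas f),
    ← lintegral_const_mul _ (hmeas g), ← lintegral_add_left ((hmeas f).const_mul _)]
  -- Suprema equal to 1 make both superlevel sets nonempty at every level below 1, as
  -- Brunn–Minkowski requires.
  refine le_trans (setLIntegral_mono' measurableSet_Ioo fun t ht => ?_)
    (lintegral_mono_set Set.Ioo_subset_Ioi_self)
  have scale : ∀ (c : ℝ), 0 < c → ∀ A : Set ℝ, ENNReal.ofReal c * volume A =
      volume ((fun x => c * x) '' A) := fun c hc A => by
    have := Measure.addHaar_smul (volume : Measure ℝ) c A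
    simp only [Module.finrank_self, pow_one, abs_of_pos hc] at this
    rw [← this]; rfl
  have ms : ∀ (c : ℝ), 0 < c → ∀ A : Set ℝ, MeasurableSet A →
      MeasurableSet ((fun x => c * x) '' A) := fun c hc A hA =>
    (MeasurableEquiv.mulLeft₀ c hc.ne').measurableEmbedding.measurableSet_image.2 hA
  rw [scale μ hμ, scale ν hν]
  refine volume_add_volume_le (ms μ hμ _ (measurableSet_lt measurable_const hfm))
    (ms ν hν _ (measurableSet_lt measurable_const hgm)) (.image _ (hfs t ht.2))
    (.image _ (hgs t ht.2)) ?_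
  rintro _ ⟨x, hx, rfl⟩ _ ⟨y, hy, rfl⟩
  exact H x y t ht.1 hx hy

/-- A version of `convex_comb_lintegral_le` for arbitrary suprema. -/
theorem convex_comb_integral_le {f g h : ℝ → ℝ} {μ ν M N m : ℝ} (hμ : 0 < μ) (hν : 0 < ν)
    (hfm : Measurable f) (hgm : Measurable g) (hhm : Measurable h)
    (hf0 : ∀ x, 0 ≤ f x) (hg0 : ∀ x, 0 ≤ g x) (hh0 : ∀ x, 0 ≤ h x)
    (hf : Integrable f) (hg : Integrable g) (hh : Integrable h)
    (hM : 0 < M) (hN : 0 < N) (hm : 0 < m)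
    (hfM : IsLUB (Set.range f) M) (hgN : IsLUB (Set.range g) N)
    (H : ∀ x y c, 0 < c → c * M < f x → c * N < g y → c * m < h (μ * x + ν * y)) :
    μ * ((∫ x, f x) / M) + ν * ((∫ x, g x) / N) ≤ (∫ x, h x) / m := by
  have sup : ∀ {φ : ℝ → ℝ} {K : ℝ}, 0 < K → IsLUB (Set.range φ) K →
      ∀ c < 1, ∃ x, c < φ x / K := by
    intro φ K hK hφ c hc
    obtain ⟨_, ⟨x, rfl⟩, hx, -⟩ := hφ.exists_between (show c * K < K by nlinarith)
    exact ⟨x, (lt_div_iff₀ hK).2 hx⟩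
  have := convex_comb_lintegral_le (f := fun x => f x / M) (g := fun x => g x / N)
    (h := fun x => h x / m) hμ hν (hfm.div_const _) (hgm.div_const _) (hhm.div_const _)
    (fun x => div_nonneg (hf0 x) hM.le) (fun x => div_nonneg (hg0 x) hN.le)
    (fun x => div_nonneg (hh0 x) hm.le) (fun x => (div_le_one hM).2 (hfM.1 ⟨x, rfl⟩))
    (fun x => (div_le_one hN).2 (hgN.1 ⟨x, rfl⟩)) (sup hM hfM) (sup hN hgN)
    (fun x y c hc hx hy => by
      rw [lt_div_iff₀ hm]
      exact H x y c hc ((lt_div_iff₀ hM).1 hx) ((lt_div_iff₀ hN).1 hy))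
  have hI : ∀ {φ : ℝ → ℝ} {K : ℝ}, 0 < K → (∀ x, 0 ≤ φ x) → Integrable φ →
      ∫⁻ x, ENNReal.ofReal (φ x / K) = ENNReal.ofReal ((∫ x, φ x) / K) := by
    intro φ K hK h0 hi
    rw [← ofReal_integral_eq_lintegral_ofReal (hi.div_const _)
      (Filter.Eventually.of_forall fun x => div_nonneg (h0 x) hK.le), integral_div]
  have hp : ∀ {φ : ℝ → ℝ} {K : ℝ}, 0 < K → (∀ x, 0 ≤ φ x) → 0 ≤ (∫ x, φ x) / K :=
    fun hK h0 => div_nonneg (integral_nonneg h0) hK.le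
  rw [hI hM hf0 hf, hI hN hg0 hg, hI hm hh0 hh, ← ENNReal.ofReal_mul hμ.le,
    ← ENNReal.ofReal_mul hν.le, ← ENNReal.ofReal_add (mul_nonneg hμ.le (hp hM hf0))
      (mul_nonneg hν.le (hp hN hg0))] at this
  exact (ENNReal.ofReal_le_ofReal_iff (hp hm hh0)).1 this

theorem exists_isLUB_range {f : ℝ → ℝ} {C x₀ : ℝ} (h : ∀ x, f x ≤ C) (h0 : 0 < f x₀) :
    ∃ M, 0 < M ∧ IsLUB (Set.range f) M := by
  obtain ⟨M, hM⟩ := Real.exists_isLUB (s := Set.range f) ⟨_, x₀, rfl⟩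
    ⟨C, by rintro _ ⟨x, rfl⟩; exact h x⟩
  exact ⟨M, h0.trans_le (hM.1 ⟨x₀, rfl⟩), hM⟩

/-- The one-dimensional Prékopa–Leindler inequality. -/
theorem prekopa_leindler {f g h : ℝ → ℝ} {μ ν C : ℝ} (hμ : 0 < μ) (hν : 0 < ν) (hμν : μ + ν = 1)
    (hfm : Measurable f) (hgm : Measurable g) (hhm : Measurable h)
    (hf0 : ∀ x, 0 < f x) (hg0 : ∀ x, 0 < g x) (hh0 : ∀ x, 0 < h x)
    (hf : Integrable f) (hg : Integrable g) (hh : Integrable h)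
    (hfC : ∀ x, f x ≤ C) (hgC : ∀ x, g x ≤ C)
    (H : ∀ x y, f x ^ μ * g y ^ ν ≤ h (μ * x + ν * y)) :
    (∫ x, f x) ^ μ * (∫ x, g x) ^ ν ≤ ∫ x, h x := by
  obtain ⟨M, hM, hfM⟩ := exists_isLUB_range hfC (hf0 0)
  obtain ⟨N, hN, hgN⟩ := exists_isLUB_range hgC (hg0 0)
  -- Normalising `h` by the geometric mean of the suprema makes the hypothesis pass to superlevel
  -- sets, since c ^ μ * c ^ ν = c; AM–GM then makes the additive bound multiplicative.
  have hm : 0 < M ^ μ * N ^ ν := by positivity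
  have := convex_comb_integral_le hμ hν hfm hgm hhm (fun x => (hf0 x).le) (fun x => (hg0 x).le)
    (fun x => (hh0 x).le) hf hg hh hM hN hm hfM hgN (by
      intro x y c hc hx hy
      refine lt_of_lt_of_le ?_ (H x y)
      have h1 := Real.rpow_lt_rpow (by positivity) hx hμ
      have h2 := Real.rpow_lt_rpow (by positivity) hy hν
      rw [Real.mul_rpow hc.le hM.le] at h1
      rw [Real.mul_rpow hc.le hN.le] at h2
      have h3 := mul_lt_mul'' h1 h2 (by positivity) (by positivity)
      have h4 : c ^ μ * c ^ ν = c := by rw [← Real.rpow_add hc, hμν, Real.rpow_one]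
      calc c * (M ^ μ * N ^ ν) = c ^ μ * M ^ μ * (c ^ ν * N ^ ν) := by
            conv_lhs => rw [← h4]
            ring
        _ < _ := h3)
  have hF : 0 ≤ ∫ x, f x := integral_nonneg fun x => (hf0 x).le
  have hG : 0 ≤ ∫ x, g x := integral_nonneg fun x => (hg0 x).le
  have am := Real.geom_mean_le_arith_mean2_weighted hμ.le hν.le (div_nonneg hF hM.le)
    (div_nonneg hG hN.le) hμν
  have := am.trans this
  rw [Real.div_rpow hF hM.le, Real.div_rpow hG hN.le, div_mul_div_comm,
    div_le_div_iff_of_pos_right hm] at this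
  exact this

/-- The one-dimensional Borell–Brascamp–Lieb inequality for the harmonic mean. -/
theorem min_integral_le_of_harmonic {f g h : ℝ → ℝ} {μ ν C x₀ y₀ : ℝ} (hμ : 0 < μ) (hν : 0 < ν)
    (hfm : Measurable f) (hgm : Measurable g) (hhm : Measurable h)
    (hf0 : ∀ x, 0 ≤ f x) (hg0 : ∀ x, 0 ≤ g x) (hh0 : ∀ x, 0 ≤ h x)
    (hf : Integrable f) (hg : Integrable g) (hh : Integrable h)
    (hfC : ∀ x, f x ≤ C) (hgC : ∀ x, g x ≤ C) (hx₀ : 0 < f x₀) (hy₀ : 0 < g y₀)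
    (H : ∀ x y, 0 < f x → 0 < g y → 1 ≤ h (μ * x + ν * y) * (μ / f x + ν / g y)) :
    min (∫ x, f x) (∫ x, g x) ≤ ∫ x, h x := by
  obtain ⟨M, hM, hfM⟩ := exists_isLUB_range hfC hx₀
  obtain ⟨N, hN, hgN⟩ := exists_isLUB_range hgC hy₀
  have hm : 0 < μ / M + ν / N := by positivity
  -- With `h` normalised by the harmonic mean of the suprema, ∫ h is at least the average of ∫ f and
  -- ∫ g with weights proportional to μ/M and ν/N, hence at least their minimum.
  have := convex_comb_integral_le hμ hν hfm hgm hhm hf0 hg0 hh0 hf hg hh hM hN (inv_pos.2 hm)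
    hfM hgN (by
      intro x y c hc hx hy
      have hfx : 0 < f x := lt_trans (by positivity) hx
      have hgy : 0 < g y := lt_trans (by positivity) hy
      have h1 := H x y hfx hgy
      have h2 : μ / f x < μ / (c * M) := div_lt_div_of_pos_left hμ (by positivity) hx
      have h3 : ν / g y < ν / (c * N) := div_lt_div_of_pos_left hν (by positivity) hy
      have h4 : μ / (c * M) + ν / (c * N) = (μ / M + ν / N) / c := by field_simp
      have h5 : 0 < h (μ * x + ν * y) := by
        refine lt_of_le_of_ne (hh0 _) fun h0 => ?_
        rw [← h0] at h1; linarith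
      have h6 : 1 < h (μ * x + ν * y) * ((μ / M + ν / N) / c) :=
        h1.trans_lt (mul_lt_mul_of_pos_left (by linarith) h5)
      rw [← div_eq_mul_inv, div_lt_iff₀ hm]
      rwa [← mul_div_assoc, lt_div_iff₀ hc, one_mul] at h6)
  rw [div_inv_eq_mul] at this
  have h1 : μ / M * min (∫ x, f x) (∫ x, g x) ≤ μ / M * ∫ x, f x :=
    mul_le_mul_of_nonneg_left (min_le_left _ _) (by positivity)
  have h2 : ν / N * min (∫ x, f x) (∫ x, g x) ≤ ν / N * ∫ x, g x :=
    mul_le_mul_of_nonneg_left (min_le_right _ _) (by positivity)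
  have h3 : min (∫ x, f x) (∫ x, g x) * (μ / M + ν / N) ≤ (∫ x, h x) * (μ / M + ν / N) := by
    calc _ = μ / M * min (∫ x, f x) (∫ x, g x) + ν / N * min (∫ x, f x) (∫ x, g x) := by ring
      _ ≤ μ / M * (∫ x, f x) + ν / N * ∫ x, g x := add_le_add h1 h2
      _ = μ * ((∫ x, f x) / M) + ν * ((∫ x, g x) / N) := by ring
      _ ≤ _ := this
  exact le_of_mul_le_mul_right h3 hm

/-- Turns log-concavity into the harmonic-mean hypothesis after the inversion a = 1/x. With z = μx +
νy, the weights μx/z and νy/z express 1/z as a convex combination of 1/x and 1/y. Weighted AM–GM is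
used twice, once for the factors A, B and once for the Jacobians x⁻², y⁻². -/
theorem one_le_harmonic_of_rpow_le {μ ν x y A B P : ℝ} (hμ : 0 < μ) (hν : 0 < ν) (hμν : μ + ν = 1)
    (hx : 0 < x) (hy : 0 < y) (hA : 0 < A) (hB : 0 < B)
    (hP : A ^ (μ * x / (μ * x + ν * y)) * B ^ (ν * y / (μ * x + ν * y)) ≤ P) :
    1 ≤ (((μ * x + ν * y) ^ 2)⁻¹ * P) * (μ / ((x ^ 2)⁻¹ * A) + ν / ((y ^ 2)⁻¹ * B)) := by
  have hz : 0 < μ * x + ν * y := by positivity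
  set z := μ * x + ν * y with hzdef
  set a := μ * x / z with ha
  set b := ν * y / z with hb
  have ha0 : 0 < a := by positivity
  have hb0 : 0 < b := by positivity
  have hab : a + b = 1 := by rw [ha, hb, ← add_div, ← hzdef, div_self hz.ne']
  have h1 : (z / x) ^ a * (z / y) ^ b ≤ 1 := by
    refine (Real.geom_mean_le_arith_mean2_weighted ha0.le hb0.le (by positivity) (by positivity)
      hab).trans (le_of_eq ?_)
    rw [ha, hb, ← hμν]
    field_simp
  have h2 := Real.geom_mean_le_arith_mean2_weighted ha0.le hb0.le
    (show 0 ≤ (x / z) / A by positivity) (show 0 ≤ (y / z) / B by positivity) hab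
  have h3 : (z ^ 2)⁻¹ * (μ / ((x ^ 2)⁻¹ * A) + ν / ((y ^ 2)⁻¹ * B))
      = a * ((x / z) / A) + b * ((y / z) / B) := by
    rw [ha, hb]; field_simp
  have h4 : ((x / z) / A) ^ a * ((y / z) / B) ^ b * (A ^ a * B ^ b) *
      ((z / x) ^ a * (z / y) ^ b) = 1 := by
    calc _ = (((x / z) / A) ^ a * A ^ a * (z / x) ^ a) *
          (((y / z) / B) ^ b * B ^ b * (z / y) ^ b) := by ring
      _ = 1 := by
        rw [← Real.mul_rpow (by positivity) hA.le, ← Real.mul_rpow (by positivity) (by positivity),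
          ← Real.mul_rpow (by positivity) hB.le, ← Real.mul_rpow (by positivity) (by positivity)]
        have e1 : x / z / A * A * (z / x) = 1 := by field_simp
        have e2 : y / z / B * B * (z / y) = 1 := by field_simp
        rw [e1, e2, Real.one_rpow, Real.one_rpow, one_mul]
  have hP0 : 0 < A ^ a * B ^ b := by positivity
  calc (1 : ℝ) = ((x / z) / A) ^ a * ((y / z) / B) ^ b * (A ^ a * B ^ b) *
      ((z / x) ^ a * (z / y) ^ b) := h4.symm
    _ ≤ ((x / z) / A) ^ a * ((y / z) / B) ^ b * (A ^ a * B ^ b) * 1 :=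
      mul_le_mul_of_nonneg_left h1 (by positivity)
    _ ≤ (a * ((x / z) / A) + b * ((y / z) / B)) * P := by
      rw [mul_one]
      exact mul_le_mul h2 hP hP0.le (by positivity)
    _ = _ := by rw [← h3]; ring

/-! ### Busemann's inequality for log-concave functions -/

/-- `E` is a positive log-concave function of three real variables. -/
structure IsLogConcave₃ (E : ℝ → ℝ → ℝ → ℝ) : Prop where
  cont : Continuous fun q : ℝ × ℝ × ℝ => E q.1 q.2.1 q.2.2
  pos : ∀ a b c, 0 < E a b c
  rpow_mul_le : ∀ μ ν, 0 < μ → 0 < ν → μ + ν = 1 → ∀ a b c a' b' c',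
    E a b c ^ μ * E a' b' c' ^ ν ≤ E (μ * a + ν * a') (μ * b + ν * b') (μ * c + ν * c')

section GaussianBound

variable {E : ℝ → ℝ → ℝ → ℝ} {ε : ℝ}

theorem integrable_middle (hE : IsLogConcave₃ E) (hε : 0 < ε)
    (hb : ∀ a b c, E a b c ≤ Real.exp (-ε * (a ^ 2 + b ^ 2))) (a c : ℝ) :
    Integrable fun b => E a b c := by
  refine (integrable_exp_neg_mul_sq hε).mono'
    (hE.cont.comp (f := fun b => (a, b, c)) (by fun_prop)).aestronglyMeasurable
    (Filter.Eventually.of_forall fun b => ?_)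
  rw [Real.norm_eq_abs, abs_of_pos (hE.pos a b c)]
  refine (hb a b c).trans (Real.exp_le_exp.2 ?_)
  nlinarith [mul_nonneg hε.le (sq_nonneg a)]

theorem continuous_integral_middle (hE : IsLogConcave₃ E) (hε : 0 < ε)
    (hb : ∀ a b c, E a b c ≤ Real.exp (-ε * (a ^ 2 + b ^ 2))) :
    Continuous fun q : ℝ × ℝ => ∫ b, E q.1 b q.2 := by
  refine continuous_of_dominated (bound := fun b => Real.exp (-ε * b ^ 2))
    (fun q => (integrable_middle hE hε hb q.1 q.2).aestronglyMeasurable)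
    (fun q => Filter.Eventually.of_forall fun b => ?_) (integrable_exp_neg_mul_sq hε)
    (Filter.Eventually.of_forall fun b =>
      hE.cont.comp (f := fun q : ℝ × ℝ => (q.1, b, q.2)) (by fun_prop))
  rw [Real.norm_eq_abs, abs_of_pos (hE.pos q.1 b q.2)]
  refine (hb _ _ _).trans (Real.exp_le_exp.2 ?_)
  nlinarith [mul_nonneg hε.le (sq_nonneg q.1)]

theorem integral_middle_pos (hE : IsLogConcave₃ E) (hε : 0 < ε)
    (hb : ∀ a b c, E a b c ≤ Real.exp (-ε * (a ^ 2 + b ^ 2))) (a c : ℝ) :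
    0 < ∫ b, E a b c := by
  rw [integral_pos_iff_support_of_nonneg (fun b => (hE.pos a b c).le)
    (integrable_middle hE hε hb a c)]
  have : Function.support (fun b => E a b c) = Set.univ := by
    ext b; simp [(hE.pos a b c).ne']
  simp [this]

theorem integral_middle_le (hE : IsLogConcave₃ E) (hε : 0 < ε)
    (hb : ∀ a b c, E a b c ≤ Real.exp (-ε * (a ^ 2 + b ^ 2))) (a c : ℝ) :
    ∫ b, E a b c ≤ (∫ b, Real.exp (-ε * b ^ 2)) * Real.exp (-ε * a ^ 2) := by
  rw [← integral_mul_const]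
  refine integral_mono (integrable_middle hE hε hb a c)
    ((integrable_exp_neg_mul_sq hε).mul_const _) fun b => (hb a b c).trans (le_of_eq ?_)
  rw [← Real.exp_add]; ring_nf

/-- Marginals of log-concave functions are log-concave, by Prékopa–Leindler in the variable b. -/
theorem integral_middle_rpow_mul_le (hE : IsLogConcave₃ E) (hε : 0 < ε)
    (hb : ∀ a b c, E a b c ≤ Real.exp (-ε * (a ^ 2 + b ^ 2))) {μ ν : ℝ} (hμ : 0 < μ) (hν : 0 < ν)
    (hμν : μ + ν = 1) (a c a' c' : ℝ) :
    (∫ b, E a b c) ^ μ * (∫ b, E a' b c') ^ ν ≤ ∫ b, E (μ * a + ν * a') b (μ * c + ν * c') := by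
  have hm : ∀ a c, Measurable fun b => E a b c := fun a c =>
    (hE.cont.comp (f := fun b => (a, b, c)) (by fun_prop)).measurable
  have h1 : ∀ a b c, E a b c ≤ 1 := fun a b c => (hb a b c).trans (Real.exp_le_one_iff.2 (by
    nlinarith [mul_nonneg hε.le (sq_nonneg a), mul_nonneg hε.le (sq_nonneg b)]))
  exact prekopa_leindler hμ hν hμν (hm _ _) (hm _ _) (hm _ _) (fun b => hE.pos _ b _)
    (fun b => hE.pos _ b _) (fun b => hE.pos _ b _) (integrable_middle hE hε hb _ _)
    (integrable_middle hE hε hb _ _) (integrable_middle hE hε hb _ _) (fun b => h1 _ _ _)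
    (fun b => h1 _ _ _) (fun x y => hE.rpow_mul_le μ ν hμ hν hμν _ _ _ _ _ _)

theorem integrable_slope (hE : IsLogConcave₃ E) (hε : 0 < ε)
    (hb : ∀ a b c, E a b c ≤ Real.exp (-ε * (a ^ 2 + b ^ 2))) (t : ℝ) :
    Integrable fun a => ∫ b, E a b (t * a) := by
  refine ((integrable_exp_neg_mul_sq hε).const_mul (∫ b, Real.exp (-ε * b ^ 2))).mono'
    ((continuous_integral_middle hE hε hb).comp
      (f := fun a => (a, t * a)) (by fun_prop)).aestronglyMeasurable
    (Filter.Eventually.of_forall fun a => ?_)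
  rw [Real.norm_eq_abs, abs_of_pos (integral_middle_pos hE hε hb _ _)]
  exact integral_middle_le hE hε hb _ _

/-- The integral over a half-plane, after inversion of the slope variable. -/
theorem integral_slope_inv (t : ℝ) :
    ∫ x, (Set.Ioi (0 : ℝ)).indicator (fun x => (x ^ 2)⁻¹ * ∫ b, E x⁻¹ b (t * x⁻¹)) x
      = ∫ a in Set.Ioi (0 : ℝ), ∫ b, E a b (t * a) := by
  rw [integral_indicator measurableSet_Ioi,
    ← integral_comp_rpow_Ioi (fun a => ∫ b, E a b (t * a)) (p := -1) (by norm_num)]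
  refine setIntegral_congr_fun measurableSet_Ioi fun x hx => ?_
  have hx : 0 < x := hx
  have h2 : x ^ (-1 - 1 : ℝ) = (x ^ 2)⁻¹ := by
    rw [show (-1 - 1 : ℝ) = -(2 : ℕ) by norm_num, Real.rpow_neg hx.le, Real.rpow_natCast]
  simp only [abs_neg, abs_one, one_mul, smul_eq_mul, h2, Real.rpow_neg_one]

theorem integrable_slope_inv (hE : IsLogConcave₃ E) (hε : 0 < ε)
    (hb : ∀ a b c, E a b c ≤ Real.exp (-ε * (a ^ 2 + b ^ 2))) (t : ℝ) :
    Integrable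
      ((Set.Ioi (0 : ℝ)).indicator (fun x => (x ^ 2)⁻¹ * ∫ b, E x⁻¹ b (t * x⁻¹))) := by
  rw [integrable_indicator_iff measurableSet_Ioi]
  have := (integrableOn_Ioi_comp_rpow_iff (fun a => ∫ b, E a b (t * a)) (p := -1)
    (by norm_num)).2 (integrable_slope hE hε hb t).integrableOn
  refine this.congr_fun (fun x hx => ?_) measurableSet_Ioi
  have hx : 0 < x := hx
  have h2 : x ^ (-1 - 1 : ℝ) = (x ^ 2)⁻¹ := by
    rw [show (-1 - 1 : ℝ) = -(2 : ℕ) by norm_num, Real.rpow_neg hx.le, Real.rpow_natCast]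
  simp only [abs_neg, abs_one, one_mul, smul_eq_mul, h2, Real.rpow_neg_one]

/-- Busemann's inequality on half-planes, for log-concave functions with a Gaussian bound. -/
theorem min_integral_slope_le (hE : IsLogConcave₃ E) (hε : 0 < ε)
    (hb : ∀ a b c, E a b c ≤ Real.exp (-ε * (a ^ 2 + b ^ 2))) {t₀ t₁ : ℝ} (h₀ : t₀ < 0)
    (h₁ : 0 < t₁) :
    min (∫ a in Set.Ioi (0 : ℝ), ∫ b, E a b (t₀ * a)) (∫ a in Set.Ioi (0 : ℝ), ∫ b, E a b (t₁ * a))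
      ≤ ∫ a in Set.Ioi (0 : ℝ), ∫ b, E a b (0 * a) := by
  rw [← integral_slope_inv, ← integral_slope_inv, ← integral_slope_inv]
  set f : ℝ → ℝ → ℝ := fun t =>
    (Set.Ioi (0 : ℝ)).indicator (fun x => (x ^ 2)⁻¹ * ∫ b, E x⁻¹ b (t * x⁻¹)) with hf
  have hpos : ∀ t x, 0 < x → f t x = (x ^ 2)⁻¹ * ∫ b, E x⁻¹ b (t * x⁻¹) := fun t x hx => by
    rw [hf]; exact Set.indicator_of_mem (Set.mem_Ioi.2 hx) _
  have hneg : ∀ t x, x ≤ 0 → f t x = 0 := fun t x hx => by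
    rw [hf]; exact Set.indicator_of_notMem (by simpa using hx) _
  have hpp : ∀ t x, 0 < x → 0 < f t x := fun t x hx => by
    rw [hpos t x hx]
    exact mul_pos (by positivity) (integral_middle_pos hE hε hb _ _)
  have hnn : ∀ t x, 0 ≤ f t x := fun t x => by
    rcases lt_or_ge 0 x with hx | hx
    exacts [(hpp t x hx).le, (hneg t x hx).ge]
  have hxp : ∀ t x, 0 < f t x → 0 < x := fun t x h => by
    by_contra hx
    rw [hneg t x (not_lt.1 hx)] at h
    exact lt_irrefl _ h
  have hmeas : ∀ t, Measurable (f t) := fun t => by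
    refine Measurable.indicator (Measurable.mul (by fun_prop) ?_) measurableSet_Ioi
    exact (continuous_integral_middle hE hε hb).measurable.comp
      (f := fun x : ℝ => (x⁻¹, t * x⁻¹)) (by fun_prop)
  set K := ∫ b, Real.exp (-ε * b ^ 2) with hK
  have hK0 : 0 ≤ K := integral_nonneg fun b => (Real.exp_pos _).le
  have hbd : ∀ t x, f t x ≤ K / ε := fun t x => by
    rcases lt_or_ge 0 x with hx | hx
    · rw [hpos t x hx]
      have h1 := integral_middle_le hE hε hb x⁻¹ (t * x⁻¹)
      -- This is s ≤ exp s at s = ε/x²: the Gaussian beats the Jacobian near x = 0.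
      have h2 : (x ^ 2)⁻¹ * Real.exp (-ε * x⁻¹ ^ 2) ≤ 1 / ε := by
        have := Real.add_one_le_exp (ε * x⁻¹ ^ 2)
        rw [neg_mul, Real.exp_neg, ← inv_pow, ← div_eq_mul_inv, div_le_div_iff₀ (Real.exp_pos _) hε]
        linarith
      calc _ ≤ (x ^ 2)⁻¹ * (K * Real.exp (-ε * x⁻¹ ^ 2)) :=
            mul_le_mul_of_nonneg_left h1 (by positivity)
        _ = K * ((x ^ 2)⁻¹ * Real.exp (-ε * x⁻¹ ^ 2)) := by ring
        _ ≤ K * (1 / ε) := mul_le_mul_of_nonneg_left h2 hK0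
        _ = K / ε := by ring
    · rw [hneg t x hx]; positivity
  have hd : 0 < t₁ - t₀ := by linarith
  -- The weights for which μt₀ + νt₁ = 0, so that the two slopes average to 0.
  have hμ : 0 < t₁ / (t₁ - t₀) := div_pos h₁ hd
  have hν : 0 < -t₀ / (t₁ - t₀) := div_pos (by linarith) hd
  have hμν : t₁ / (t₁ - t₀) + -t₀ / (t₁ - t₀) = 1 := by field_simp; ring
  have hbal : t₁ / (t₁ - t₀) * t₀ + -t₀ / (t₁ - t₀) * t₁ = 0 := by field_simp; ring
  generalize t₁ / (t₁ - t₀) = μ at *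
  generalize -t₀ / (t₁ - t₀) = ν at *
  refine min_integral_le_of_harmonic hμ hν (hmeas t₀) (hmeas t₁) (hmeas 0) (hnn t₀) (hnn t₁)
    (hnn 0) (integrable_slope_inv hE hε hb t₀) (integrable_slope_inv hE hε hb t₁)
    (integrable_slope_inv hE hε hb 0) (hbd t₀) (hbd t₁) (hpp t₀ 1 one_pos) (hpp t₁ 1 one_pos)
    fun x y hx hy => ?_
  replace hx := hxp _ _ hx
  replace hy := hxp _ _ hy
  have hz : 0 < μ * x + ν * y := by positivity
  change 1 ≤ f 0 (μ * x + ν * y) * (μ / f t₀ x + ν / f t₁ y)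
  rw [hpos _ _ hx, hpos _ _ hy, hpos _ _ hz]
  refine one_le_harmonic_of_rpow_le hμ hν hμν hx hy (integral_middle_pos hE hε hb _ _)
    (integral_middle_pos hE hε hb _ _) ?_
  -- With weights μx/z and νy/z, where z = μx + νy, the points (1/x, t₀/x) and (1/y, t₁/y) combine
  -- to (1/z, 0).
  refine (integral_middle_rpow_mul_le hE hε hb (by positivity) (by positivity)
    (by rw [← add_div, div_self hz.ne']) _ _ _ _).trans (le_of_eq ?_)
  have e1 : μ * x / (μ * x + ν * y) * x⁻¹ + ν * y / (μ * x + ν * y) * y⁻¹ = (μ * x + ν * y)⁻¹ := by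
    field_simp; exact hμν
  have e2 : μ * x / (μ * x + ν * y) * (t₀ * x⁻¹) + ν * y / (μ * x + ν * y) * (t₁ * y⁻¹)
      = 0 * (μ * x + ν * y)⁻¹ := by
    field_simp; linarith
  rw [e1, e2]

/-- Evenness makes the two half-planes contribute equally; the inversion a = 1/x only handles a > 0.
-/
theorem lintegral_slope_eq (hE : IsLogConcave₃ E) (hε : 0 < ε)
    (hb : ∀ a b c, E a b c ≤ Real.exp (-ε * (a ^ 2 + b ^ 2)))
    (heven : ∀ a b c, E (-a) (-b) (-c) = E a b c) (t : ℝ) :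
    ∫⁻ a, ∫⁻ b, ENNReal.ofReal (E a b (t * a))
      = ENNReal.ofReal (2 * ∫ a in Set.Ioi (0 : ℝ), ∫ b, E a b (t * a)) := by
  have h1 : ∀ a, ∫⁻ b, ENNReal.ofReal (E a b (t * a)) = ENNReal.ofReal (∫ b, E a b (t * a)) :=
    fun a => (ofReal_integral_eq_lintegral_ofReal (integrable_middle hE hε hb _ _)
      (Filter.Eventually.of_forall fun b => (hE.pos _ _ _).le)).symm
  have hi := integrable_slope hE hε hb t
  simp_rw [h1]
  rw [← ofReal_integral_eq_lintegral_ofReal hi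
    (Filter.Eventually.of_forall fun a => (integral_middle_pos hE hε hb _ _).le)]
  congr 1
  rw [← integral_add_compl (measurableSet_Ioi (a := (0 : ℝ))) hi, Set.compl_Ioi,
    ← neg_zero (G := ℝ), ← integral_comp_neg_Ioi, neg_zero, two_mul]
  congr 1
  refine setIntegral_congr_fun measurableSet_Ioi fun a _ => ?_
  rw [← integral_neg_eq_self]
  refine integral_congr_ae (Filter.Eventually.of_forall fun b => ?_)
  change E (-a) (-b) (t * -a) = E a b (t * a)
  rw [mul_neg, heven]

end GaussianBound

/-- Busemann's inequality for even log-concave functions bounded by `1`. -/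
theorem min_lintegral_slope_le {E : ℝ → ℝ → ℝ → ℝ} (hE : IsLogConcave₃ E)
    (h1 : ∀ a b c, E a b c ≤ 1) (heven : ∀ a b c, E (-a) (-b) (-c) = E a b c) {t₀ t₁ : ℝ}
    (h₀ : t₀ < 0) (h₁ : 0 < t₁) :
    min (∫⁻ a, ∫⁻ b, ENNReal.ofReal (E a b (t₀ * a))) (∫⁻ a, ∫⁻ b, ENNReal.ofReal (E a b (t₁ * a)))
      ≤ ∫⁻ a, ∫⁻ b, ENNReal.ofReal (E a b (0 * a)) := by
  -- Gaussian damping supplies integrability while preserving evenness and log-concavity. It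
  -- increases to `E`, so monotone convergence removes it. No decay in c is needed, because c = ta.
  set G : ℕ → ℝ → ℝ → ℝ → ℝ := fun n a b c =>
    E a b c * Real.exp (-(1 / ((n : ℝ) + 1)) * (a ^ 2 + b ^ 2)) with hG
  have hε : ∀ n : ℕ, 0 < 1 / ((n : ℝ) + 1) := fun n => by positivity
  have hGb : ∀ n a b c, G n a b c ≤ Real.exp (-(1 / ((n : ℝ) + 1)) * (a ^ 2 + b ^ 2)) :=
    fun n a b c => mul_le_of_le_one_left (Real.exp_pos _).le (h1 a b c)
  have hGe : ∀ n a b c, G n (-a) (-b) (-c) = G n a b c := fun n a b c => by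
    simp [hG, heven]
  have hGl : ∀ n, IsLogConcave₃ (G n) := fun n => by
    refine ⟨hE.cont.mul (by fun_prop), fun a b c => mul_pos (hE.pos a b c) (Real.exp_pos _),
      fun μ ν hμ hν hμν a b c a' b' c' => ?_⟩
    simp only [hG]
    rw [Real.mul_rpow (hE.pos _ _ _).le (Real.exp_pos _).le,
      Real.mul_rpow (hE.pos _ _ _).le (Real.exp_pos _).le, mul_mul_mul_comm]
    refine mul_le_mul (hE.rpow_mul_le μ ν hμ hν hμν a b c a' b' c') ?_ (by positivity)
      (hE.pos _ _ _).le
    rw [← Real.exp_mul, ← Real.exp_mul, ← Real.exp_add, Real.exp_le_exp]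
    have key : ∀ s s' : ℝ, (μ * s + ν * s') ^ 2 ≤ μ * s ^ 2 + ν * s' ^ 2 := fun s s' => by
      have : μ * s ^ 2 + ν * s' ^ 2 - (μ * s + ν * s') ^ 2 = μ * ν * (s - s') ^ 2 := by
        obtain rfl : ν = 1 - μ := by linarith
        ring
      nlinarith [mul_nonneg (mul_nonneg hμ.le hν.le) (sq_nonneg (s - s'))]
    have := mul_le_mul_of_nonneg_left (add_le_add (key a a') (key b b')) (hε n).le
    linarith
  have lim : ∀ t, Filter.Tendsto (fun n => ∫⁻ a, ∫⁻ b, ENNReal.ofReal (G n a b (t * a)))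
      Filter.atTop (nhds (∫⁻ a, ∫⁻ b, ENNReal.ofReal (E a b (t * a)))) := by
    intro t
    have hmono : ∀ a b c, Monotone fun n => ENNReal.ofReal (G n a b c) := fun a b c n m hnm => by
      refine ENNReal.ofReal_le_ofReal (mul_le_mul_of_nonneg_left (Real.exp_le_exp.2 ?_)
        (hE.pos _ _ _).le)
      refine mul_le_mul_of_nonneg_right (neg_le_neg ?_) (by positivity)
      exact one_div_le_one_div_of_le (by positivity) (by exact_mod_cast Nat.succ_le_succ hnm)
    have hlim : ∀ a b c, Filter.Tendsto (fun n => ENNReal.ofReal (G n a b c)) Filter.atTop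
        (nhds (ENNReal.ofReal (E a b c))) := fun a b c => by
      refine ENNReal.tendsto_ofReal ?_
      have := (((tendsto_one_div_add_atTop_nhds_zero_nat (𝕜 := ℝ)).neg.mul_const
        (a ^ 2 + b ^ 2)).rexp).const_mul (E a b c)
      simpa [hG] using this
    have hm : ∀ n, Measurable fun q : ℝ × ℝ => ENNReal.ofReal (G n q.1 q.2 (t * q.1)) := fun n =>
      ((hGl n).cont.comp (f := fun q : ℝ × ℝ => (q.1, q.2, t * q.1))
        (by fun_prop)).measurable.ennreal_ofReal
    refine lintegral_tendsto_of_tendsto_of_monotone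
      (fun n => (hm n).lintegral_prod_right'.aemeasurable)
      (Filter.Eventually.of_forall fun a n m hnm => lintegral_mono fun b => hmono _ _ _ hnm)
      (Filter.Eventually.of_forall fun a => ?_)
    exact lintegral_tendsto_of_tendsto_of_monotone
      (fun n => ((hm n).comp (measurable_prodMk_left (x := a))).aemeasurable)
      (Filter.Eventually.of_forall fun b => hmono _ _ _)
      (Filter.Eventually.of_forall fun b => hlim _ _ _)
  refine le_of_tendsto_of_tendsto' ((lim t₀).min (lim t₁)) (lim 0) fun n => ?_
  rw [lintegral_slope_eq (hGl n) (hε n) (hGb n) (hGe n),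
    lintegral_slope_eq (hGl n) (hε n) (hGb n) (hGe n),
    lintegral_slope_eq (hGl n) (hε n) (hGb n) (hGe n)]
  have := min_integral_slope_le (hGl n) (hε n) (hGb n) h₀ h₁
  rcases min_le_iff.1 this with h | h
  · exact (min_le_left _ _).trans (ENNReal.ofReal_le_ofReal (by linarith))
  · exact (min_le_right _ _).trans (ENNReal.ofReal_le_ofReal (by linarith))

/-! ### Linear coordinates and area-preserving shears -/

/-- The Jacobian `c` can stay unspecified: it depends on the basis alone and is common to all the
integrals compared. -/
theorem exists_lintegral_eq_const_mul {e₁ e₂ : Plane}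
    (h : ∀ a b : ℝ, a • e₁ + b • e₂ = 0 → a = 0 ∧ b = 0) :
    ∃ c : ENNReal, ∀ f : Plane → ENNReal, Measurable f →
      ∫⁻ y, f y = c * ∫⁻ a : ℝ, ∫⁻ b : ℝ, f (a • e₁ + b • e₂) := by
  let φ : ℝ × ℝ →ₗ[ℝ] Plane :=
    (LinearMap.toSpanSingleton ℝ Plane e₁).coprod (LinearMap.toSpanSingleton ℝ Plane e₂)
  have hφ : Function.Injective φ := by
    rw [injective_iff_map_eq_zero]
    rintro ⟨a, b⟩ hab
    obtain ⟨rfl, rfl⟩ := h a b (by simpa [φ] using hab)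
    rfl
  let Φ : (ℝ × ℝ) ≃L[ℝ] Plane :=
    (φ.linearEquivOfInjective hφ (by simp)).toContinuousLinearEquiv
  have hΦ : ∀ a b, Φ (a, b) = a • e₁ + b • e₂ := fun a b => by
    change φ (a, b) = _
    simp [φ]
  obtain ⟨c, hc⟩ : ∃ c : NNReal, (volume : Measure Plane) = c • Measure.map Φ volume :=
    ⟨_, Measure.isAddLeftInvariant_eq_smul _ _⟩
  refine ⟨c, fun f hf => ?_⟩
  have hΦm : Measurable Φ := Φ.continuous.measurable
  rw [hc, ENNReal.smul_def, lintegral_smul_measure, lintegral_map hf hΦm, Measure.volume_eq_prod,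
    lintegral_prod (fun q => f (Φ q)) (hf.comp hΦm).aemeasurable]
  simp_rw [hΦ, smul_eq_mul]

/-- A shear of the plane preserves area. -/
theorem measurePreserving_shear {l : Plane →ₗ[ℝ] ℝ} {d u : Plane} (hd : d ≠ 0) (hld : l d = 0)
    (hlu : l u = 1) {φ : ℝ → ℝ} (hφ : Continuous φ) :
    MeasurePreserving (fun x : Plane => x + φ (l x) • d) := by
  have hl : Continuous l := l.continuous_of_finiteDimensional
  have hT : Measurable fun x : Plane => x + φ (l x) • d :=
    Continuous.measurable (by fun_prop)
  obtain ⟨c, hc⟩ := exists_lintegral_eq_const_mul (e₁ := u) (e₂ := d) (by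
    intro a b hab
    have ha : a = 0 := by simpa [hld, hlu] using congrArg l hab
    subst ha
    simpa [hd] using hab)
  refine ⟨hT, ?_⟩
  refine Measure.ext fun s hs => ?_
  rw [Measure.map_apply hT hs, ← lintegral_indicator_one (hT hs), ← lintegral_indicator_one hs,
    hc _ (measurable_one.indicator (hT hs)), hc _ (measurable_one.indicator hs)]
  congr 1
  refine lintegral_congr fun a => ?_
  -- On the line l = a the shear is the translation by φ a along d.
  rw [← lintegral_add_right_eq_self (fun b : ℝ => s.indicator 1 (a • u + b • d)) (φ a)]
  refine lintegral_congr fun b => ?_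
  have e : a • u + b • d + φ (l (a • u + b • d)) • d = a • u + (b + φ a) • d := by
    simp [hld, hlu, add_smul, add_assoc]
  change Set.indicator s 1 (a • u + b • d + φ (l (a • u + b • d)) • d) = _
  rw [e]

/-! ### The functional along an odd shear -/

section Laplace

variable {p : ℝ} {S : Set Plane} {A B C : Plane → ℝ}

theorem integrableOn_exp (hS : IsCompact S) (hA : Continuous A) (hB : Continuous B)
    (hC : Continuous C) (a b c : ℝ) :
    IntegrableOn (fun x => Real.exp (p * (a * A x + b * B x + c * C x))) S :=
  (Continuous.continuousOn (by fun_prop)).integrableOn_compact hS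

theorem setIntegral_exp_pos (hS : IsCompact S) (hV : 0 < volume.real S) (hA : Continuous A)
    (hB : Continuous B) (hC : Continuous C) (a b c : ℝ) :
    0 < ∫ x in S, Real.exp (p * (a * A x + b * B x + c * C x)) := by
  have : NeZero (volume.restrict S) := ⟨fun h => by
    rw [Measure.restrict_eq_zero] at h
    simp [Measure.real, h] at hV⟩
  exact integral_exp_pos (integrableOn_exp hS hA hB hC a b c)

theorem setIntegral_neg_eq (hsymm : ∀ x ∈ S, -x ∈ S) (f : Plane → ℝ) :
    ∫ x in S, f (-x) = ∫ x in S, f x := by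
  have h : (fun x : Plane => -x) ⁻¹' S = S := by
    ext x
    exact ⟨fun hx => by simpa using hsymm _ hx, fun hx => hsymm _ hx⟩
  have := (Measure.measurePreserving_neg (volume : Measure Plane)).setIntegral_preimage_emb
    (MeasurableEquiv.neg Plane).measurableEmbedding f S
  rw [← this, h]

/-- Log-concavity of the reciprocal `L^p`-norm of exponentials. -/
theorem isLogConcave₃_rpow_integral_exp (hp : 0 < p) (hS : IsCompact S) (hV : 0 < volume.real S)
    (hA : Continuous A) (hB : Continuous B) (hC : Continuous C) :
    IsLogConcave₃ fun a b c =>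
      ((∫ x in S, Real.exp (p * (a * A x + b * B x + c * C x))) / volume.real S) ^ (-(1 / p)) := by
  have hJ := setIntegral_exp_pos (p := p) hS hV hA hB hC
  have hI := integrableOn_exp (p := p) hS hA hB hC
  refine ⟨?_, fun a b c => Real.rpow_pos_of_pos (div_pos (hJ a b c) hV) _, ?_⟩
  · have : Continuous fun q : ℝ × ℝ × ℝ =>
        ∫ x in S, Real.exp (p * (q.1 * A x + q.2.1 * B x + q.2.2 * C x)) :=
      continuous_parametric_integral_of_continuous (by fun_prop) hS
    exact (this.div_const _).rpow_const fun q => Or.inl (div_pos (hJ _ _ _) hV).ne'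
  · intro μ ν hμ hν hμν a b c a' b' c'
    have key : ∫ x in S, Real.exp (p * ((μ * a + ν * a') * A x + (μ * b + ν * b') * B x
        + (μ * c + ν * c') * C x)) ≤
        (∫ x in S, Real.exp (p * (a * A x + b * B x + c * C x))) ^ μ *
        (∫ x in S, Real.exp (p * (a' * A x + b' * B x + c' * C x))) ^ ν := by
      set J := ∫ x in S, Real.exp (p * (a * A x + b * B x + c * C x)) with hJdef
      set J' := ∫ x in S, Real.exp (p * (a' * A x + b' * B x + c' * C x)) with hJdef'
      have h0 : 0 < J := hJ a b c
      have h0' : 0 < J' := hJ a' b' c'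
      -- Hölder's inequality, by pointwise weighted AM–GM applied to the exponentials divided by
      -- their integrals.
      calc _ ≤ ∫ x in S, J ^ μ * J' ^ ν * (μ * (Real.exp (p * (a * A x + b * B x + c * C x)) / J)
              + ν * (Real.exp (p * (a' * A x + b' * B x + c' * C x)) / J')) := by
            refine integral_mono (hI _ _ _) (((((hI a b c).div_const _).const_mul _).add
              (((hI a' b' c').div_const _).const_mul _)).const_mul _) fun x => ?_
            have := Real.geom_mean_le_arith_mean2_weighted hμ.le hν.le
              (div_pos (Real.exp_pos (p * (a * A x + b * B x + c * C x))) h0).le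
              (div_pos (Real.exp_pos (p * (a' * A x + b' * B x + c' * C x))) h0').le hμν
            refine le_trans (le_of_eq ?_)
              (mul_le_mul_of_nonneg_left this (by positivity : 0 ≤ J ^ μ * J' ^ ν))
            rw [mul_mul_mul_comm, ← Real.mul_rpow h0.le (by positivity),
              ← Real.mul_rpow h0'.le (by positivity), mul_div_cancel₀ _ h0.ne',
              mul_div_cancel₀ _ h0'.ne', ← Real.exp_mul, ← Real.exp_mul, ← Real.exp_add]
            ring_nf
        _ = _ := by
            rw [integral_const_mul, integral_add (((hI a b c).div_const _).const_mul _)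
              (((hI a' b' c').div_const _).const_mul _), integral_const_mul, integral_const_mul,
              integral_div, integral_div, ← hJdef, ← hJdef', div_self h0.ne', div_self h0'.ne',
              mul_one, mul_one, hμν, mul_one]
    have hV' : volume.real S = volume.real S ^ μ * volume.real S ^ ν := by
      rw [← Real.rpow_add hV, hμν, Real.rpow_one]
    have key' := div_le_div_of_nonneg_right key hV.le
    conv_rhs at key' => rw [hV']
    rw [mul_div_mul_comm, ← Real.div_rpow (hJ _ _ _).le hV.le,
      ← Real.div_rpow (hJ _ _ _).le hV.le] at key'
    have := Real.rpow_le_rpow_of_nonpos (div_pos (hJ _ _ _) hV) key'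
      (show -(1 / p) ≤ 0 by rw [neg_nonpos]; positivity)
    refine le_trans (le_of_eq ?_) this
    have h1 := (div_pos (hJ a b c) hV).le
    have h2 := (div_pos (hJ a' b' c') hV).le
    rw [Real.mul_rpow (Real.rpow_nonneg h1 _) (Real.rpow_nonneg h2 _), ← Real.rpow_mul h1,
      ← Real.rpow_mul h2, ← Real.rpow_mul h1, ← Real.rpow_mul h2, mul_comm μ, mul_comm ν]

theorem rpow_integral_exp_neg (hsymm : ∀ x ∈ S, -x ∈ S) (hA : ∀ x, A (-x) = -A x)
    (hB : ∀ x, B (-x) = -B x) (hC : ∀ x, C (-x) = -C x) (a b c : ℝ) :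
    ∫ x in S, Real.exp (p * (-a * A x + -b * B x + -c * C x)) =
      ∫ x in S, Real.exp (p * (a * A x + b * B x + c * C x)) := by
  rw [← setIntegral_neg_eq hsymm]
  simp [hA, hB, hC]

/-- The origin is the midpoint of a point and its antipode. This gives the bound 1 for the
normalised `E`. -/
theorem IsLogConcave₃.le_zero {E : ℝ → ℝ → ℝ → ℝ} (hE : IsLogConcave₃ E)
    (heven : ∀ a b c, E (-a) (-b) (-c) = E a b c) (a b c : ℝ) : E a b c ≤ E 0 0 0 := by
  have := hE.rpow_mul_le (1 / 2) (1 / 2) (by norm_num) (by norm_num) (by norm_num) a b c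
    (-a) (-b) (-c)
  rw [heven, ← Real.rpow_add (hE.pos a b c)] at this
  norm_num at this
  exact this

end Laplace

theorem exp_neg_lpSupport {p : ℝ} {K : Set Plane} {y : Plane}
    (h : 0 < (∫ x in K, Real.exp (p * inner ℝ x y)) / volume.real K) :
    Real.exp (-lpSupport p K y) =
      ((∫ x in K, Real.exp (p * inner ℝ x y)) / volume.real K) ^ (-(1 / p)) := by
  rw [lpSupport, Real.exp_neg, Real.exp_log (Real.rpow_pos_of_pos h _), Real.rpow_neg h.le]

/-- Coordinates in which moving x by sd changes ⟨x, a y₁ + b y₂⟩ by exactly sa; this makes time t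
the slope of the plane c = ta. -/
theorem exists_dual_pair {d : Plane} (hd : d ≠ 0) : ∃ y₁ y₂ : Plane,
    inner ℝ d y₁ = 1 ∧ inner ℝ d y₂ = 0 ∧ ∀ a b : ℝ, a • y₁ + b • y₂ = 0 → a = 0 ∧ b = 0 := by
  have hn : inner ℝ d d ≠ 0 := inner_self_ne_zero.2 hd
  have h1 : inner ℝ d ((inner ℝ d d : ℝ)⁻¹ • d) = 1 := by
    rw [inner_smul_right, inv_mul_cancel₀ hn]
  have h2 : inner ℝ d (!₂[-d 1, d 0] : Plane) = 0 := by
    simp [PiLp.inner_apply, Fin.sum_univ_two]; ring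
  have h3 : (!₂[-d 1, d 0] : Plane) ≠ 0 := fun h => hd (by
    have e0 := congrFun (congrArg WithLp.ofLp h) 0
    have e1 := congrFun (congrArg WithLp.ofLp h) 1
    ext i
    fin_cases i
    · simpa using e1
    · simpa using e0)
  refine ⟨_, _, h1, h2, fun a b hab => ?_⟩
  have ha : a = 0 := by
    have := congrArg (fun z => inner ℝ d z) hab
    simpa only [inner_add_right, inner_smul_right _ _ a, inner_smul_right _ _ b, h1, h2, mul_one,
      mul_zero, add_zero, inner_zero_right] using this
  subst ha
  refine ⟨rfl, ?_⟩
  rw [zero_smul, zero_add, smul_eq_zero] at hab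
  exact hab.resolve_right h3

theorem measurableEmbedding_shear {l : Plane →ₗ[ℝ] ℝ} {d : Plane} (hld : l d = 0) {φ : ℝ → ℝ}
    (hφ : Continuous φ) : MeasurableEmbedding (fun x : Plane => x + φ (l x) • d) := by
  have hl : Continuous l := l.continuous_of_finiteDimensional
  refine Continuous.measurableEmbedding (by fun_prop) fun x y hxy => ?_
  have h1 : l x = l y := by simpa [hld] using congrArg l hxy
  simpa [h1] using hxy

/-- The `L^p`-Mahler volume is quasi-concave along odd shears. -/
theorem min_lpMahlerVolume_le {p : ℝ} (hp : 0 < p) {S K₀ K₁ : Set Plane} (hS : IsCompact S)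
    (hsymm : ∀ x ∈ S, -x ∈ S) {l : Plane →ₗ[ℝ] ℝ} {d u : Plane} (hd : d ≠ 0) (hld : l d = 0)
    (hlu : l u = 1) {φ : ℝ → ℝ} (hφ : Continuous φ) (hodd : ∀ s, φ (-s) = -φ s)
    {t₀ t₁ : ℝ} (h₀ : t₀ < 0) (h₁ : 0 < t₁)
    (hK₀ : (fun x : Plane => x + (t₀ * φ (l x)) • d) ⁻¹' K₀ = S)
    (hK₁ : (fun x : Plane => x + (t₁ * φ (l x)) • d) ⁻¹' K₁ = S) :
    min (lpMahlerVolume p K₀) (lpMahlerVolume p K₁) ≤ lpMahlerVolume p S := by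
  have hpres : ∀ t : ℝ, MeasurePreserving (fun x : Plane => x + (t * φ (l x)) • d) := fun t =>
    measurePreserving_shear (φ := fun s => t * φ s) hd hld hlu (by fun_prop)
  have hemb : ∀ t : ℝ, MeasurableEmbedding (fun x : Plane => x + (t * φ (l x)) • d) := fun t =>
    measurableEmbedding_shear (φ := fun s => t * φ s) hld (by fun_prop)
  have hvol : ∀ t K, (fun x : Plane => x + (t * φ (l x)) • d) ⁻¹' K = S → volume K = volume S :=
    fun t K h => by rw [← h, (hpres t).measure_preimage_emb (hemb t)]
  rcases eq_or_ne (volume S) 0 with h0 | h0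
  -- For a null set both values are 0, by the convention 0 * ⊤ = 0.
  · refine (min_le_left _ _).trans ?_
    rw [lpMahlerVolume, lpMahlerVolume, hvol t₀ K₀ hK₀, h0, zero_mul, zero_mul]
  have hV : 0 < volume.real S :=
    ENNReal.toReal_pos h0 hS.measure_lt_top.ne
  obtain ⟨y₁, y₂, hy₁, hy₂, hy⟩ := exists_dual_pair hd
  have hl : Continuous l := l.continuous_of_finiteDimensional
  have hA : Continuous fun x : Plane => (inner ℝ x y₁ : ℝ) := by fun_prop
  have hB : Continuous fun x : Plane => (inner ℝ x y₂ : ℝ) := by fun_prop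
  have hC : Continuous fun x : Plane => φ (l x) := by fun_prop
  set E : ℝ → ℝ → ℝ → ℝ := fun a b c =>
    ((∫ x in S, Real.exp (p * (a * inner ℝ x y₁ + b * inner ℝ x y₂ + c * φ (l x)))) /
      volume.real S) ^ (-(1 / p)) with hEdef
  have hE : IsLogConcave₃ E := isLogConcave₃_rpow_integral_exp hp hS hV hA hB hC
  have heven : ∀ a b c, E (-a) (-b) (-c) = E a b c := fun a b c => by
    simp only [hEdef]
    rw [rpow_integral_exp_neg (A := fun x => inner ℝ x y₁) (B := fun x => inner ℝ x y₂)
      (C := fun x => φ (l x)) hsymm (by simp) (by simp) (by simp [hodd])]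
  have hE1 : ∀ a b c, E a b c ≤ 1 := fun a b c => by
    refine (hE.le_zero heven a b c).trans (le_of_eq ?_)
    simp [hEdef, hV.ne']
  obtain ⟨c, hc⟩ := exists_lintegral_eq_const_mul hy
  have hM : ∀ t K, (fun x : Plane => x + (t * φ (l x)) • d) ⁻¹' K = S →
      lpMahlerVolume p K =
        volume S * (c * ∫⁻ a, ∫⁻ b, ENNReal.ofReal (E a b (t * a))) := by
    intro t K hK
    have hint : ∀ y : Plane, ∫ x in K, Real.exp (p * inner ℝ x y) =
        ∫ x in S, Real.exp (p * inner ℝ (x + (t * φ (l x)) • d) y) := fun y => by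
      rw [← hK]
      exact ((hpres t).setIntegral_preimage_emb (hemb t)
        (fun x => Real.exp (p * inner ℝ x y)) K).symm
    have hVK : volume.real K = volume.real S := by
      rw [Measure.real, Measure.real, hvol t K hK]
    have hcont : Continuous fun y : Plane =>
        ∫ x in S, Real.exp (p * inner ℝ (x + (t * φ (l x)) • d) y) :=
      continuous_parametric_integral_of_continuous (by fun_prop) hS
    have hpos : ∀ y : Plane,
        0 < (∫ x in S, Real.exp (p * inner ℝ (x + (t * φ (l x)) • d) y)) / volume.real S := by
      intro y
      have := setIntegral_exp_pos (p := p) (A := fun x => inner ℝ (x + (t * φ (l x)) • d) y)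
        hS hV (by fun_prop) hB hC 1 0 0
      simp only [one_mul, zero_mul, add_zero] at this
      exact div_pos this hV
    have hexp : ∀ y : Plane, Real.exp (-lpSupport p K y) =
        ((∫ x in S, Real.exp (p * inner ℝ (x + (t * φ (l x)) • d) y)) /
          volume.real S) ^ (-(1 / p)) := fun y => by
      rw [exp_neg_lpSupport, hint, hVK]
      rw [hint, hVK]; exact hpos y
    rw [lpMahlerVolume, hvol t K hK]
    simp_rw [hexp]
    rw [hc _ ((hcont.div_const _).rpow_const
      fun y => Or.inl (hpos y).ne').measurable.ennreal_ofReal]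
    congr 2
    refine lintegral_congr fun a => lintegral_congr fun b => ?_
    simp only [hEdef]
    congr 3
    refine integral_congr_ae (Filter.Eventually.of_forall fun x => ?_)
    simp only [inner_add_left, inner_add_right, inner_smul_left, inner_smul_right, hy₁, hy₂]
    congr 1
    simp only [conj_trivial]
    ring
  rw [hM t₀ K₀ hK₀, hM t₁ K₁ hK₁, hM 0 S (by simp)]
  rcases min_le_iff.1 (min_lintegral_slope_le hE hE1 heven h₀ h₁) with h | h
  · exact (min_le_left _ _).trans (by gcongr)
  · exact (min_le_right _ _).trans (by gcongr)

/-! ### Vertices and edges of a symmetric polygon -/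

/-- `V` is the vertex set of an origin-symmetric convex polygon with more than four vertices. -/
structure IsSymmVertexSet (V : Set Plane) : Prop where
  finite : V.Finite
  neg_mem : ∀ x ∈ V, -x ∈ V
  notMem_convexHull : ∀ x ∈ V, x ∉ convexHull ℝ (V \ {x})
  four_lt : 4 < V.ncard

/-- `k = 1` is the line supporting `V` along the edge `[u, v]`. -/
structure IsEdgeFunctional (V : Set Plane) (k : Plane →ₗ[ℝ] ℝ) (u v : Plane) : Prop where
  left_mem : u ∈ V
  right_mem : v ∈ V
  ne : u ≠ v
  left_eq : k u = 1
  right_eq : k v = 1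
  lt : ∀ x ∈ V, x ≠ u → x ≠ v → k x < 1

namespace IsEdgeFunctional

variable {V : Set Plane} {k : Plane →ₗ[ℝ] ℝ} {u v : Plane}

theorem symm (h : IsEdgeFunctional V k u v) : IsEdgeFunctional V k v u :=
  ⟨h.right_mem, h.left_mem, h.ne.symm, h.right_eq, h.left_eq, fun x hx h1 h2 => h.lt x hx h2 h1⟩

theorem le_one (h : IsEdgeFunctional V k u v) {x : Plane} (hx : x ∈ V) : k x ≤ 1 := by
  by_cases h1 : x = u
  · exact h1 ▸ h.left_eq.le
  by_cases h2 : x = v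
  · exact h2 ▸ h.right_eq.le
  exact (h.lt x hx h1 h2).le

end IsEdgeFunctional

theorem linearMap_plane_apply (k : Plane →ₗ[ℝ] ℝ) (x : Plane) :
    k x = k (EuclideanSpace.single 0 1) * x 0 + k (EuclideanSpace.single 1 1) * x 1 := by
  conv_lhs => rw [show x = x 0 • EuclideanSpace.single (0 : Fin 2) (1 : ℝ) +
    x 1 • EuclideanSpace.single (1 : Fin 2) (1 : ℝ) by ext i; fin_cases i <;> simp]
  rw [map_add, map_smul, map_smul, smul_eq_mul, smul_eq_mul]
  ring

theorem exists_functional_ne_zero_on_ker (f : Plane →ₗ[ℝ] ℝ) (hf : f ≠ 0) :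
    ∃ (g : Plane →ₗ[ℝ] ℝ) (y : Plane), f y = 0 ∧ g y ≠ 0 := by
  set a := f (EuclideanSpace.single 0 1)
  set b := f (EuclideanSpace.single 1 1)
  have hab : b ^ 2 + a ^ 2 ≠ 0 := fun h => hf (by
    have hb : b = 0 := by nlinarith [sq_nonneg a, sq_nonneg b]
    have ha : a = 0 := by nlinarith [sq_nonneg a, sq_nonneg b]
    ext x
    rw [linearMap_plane_apply f x]
    change a * _ + b * _ = _
    simp [ha, hb])
  refine ⟨-b • (EuclideanSpace.proj 0 : Plane →L[ℝ] ℝ).toLinearMap +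
    a • (EuclideanSpace.proj 1 : Plane →L[ℝ] ℝ).toLinearMap, !₂[-b, a], ?_, ?_⟩
  · rw [linearMap_plane_apply f]
    change a * (-b) + b * a = 0
    ring
  · have : -b * -b + a * a ≠ 0 := by convert hab using 1; ring
    simpa using this

theorem collinear_of_linearMap_eq {k : Plane →ₗ[ℝ] ℝ} (hk : k ≠ 0) {x y z : Plane}
    (hxy : k y = k x) (hxz : k z = k x) : Collinear ℝ ({x, y, z} : Set Plane) := by
  set a := k (EuclideanSpace.single 0 1) with ha
  set b := k (EuclideanSpace.single 1 1) with hb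
  have hab : a ^ 2 + b ^ 2 ≠ 0 := fun h => hk (by
    have hb0 : b = 0 := by nlinarith [sq_nonneg a, sq_nonneg b]
    have ha0 : a = 0 := by nlinarith [sq_nonneg a, sq_nonneg b]
    ext x
    rw [linearMap_plane_apply k x, ← ha, ← hb]
    simp [ha0, hb0])
  have key : ∀ q : Plane, k q = k x → ∃ r : ℝ, q = r • (!₂[-b, a] : Plane) +ᵥ x := by
    intro q hq
    rw [linearMap_plane_apply k q, linearMap_plane_apply k x, ← ha, ← hb] at hq
    refine ⟨(-b * (q 0 - x 0) + a * (q 1 - x 1)) / (a ^ 2 + b ^ 2), ?_⟩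
    ext i
    fin_cases i
    · simp
      field_simp
      linear_combination a * hq
    · simp
      field_simp
      linear_combination b * hq
  rw [collinear_iff_of_mem (p₀ := x) (by simp)]
  refine ⟨!₂[-b, a], ?_⟩
  rintro q (rfl | rfl | rfl)
  exacts [key _ rfl, key _ hxy, key _ hxz]

theorem exists_eq_smul_add_smul {k₁ k₂ : Plane →ₗ[ℝ] ℝ} {u w : Plane}
    (h : k₁ u * k₂ w - k₁ w * k₂ u ≠ 0) (x : Plane) : ∃ p q : ℝ, x = p • u + q • w := by
  have hli : LinearIndependent ℝ ![u, w] := by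
    rw [LinearIndependent.pair_iff]
    intro s t hst
    have h1 : s * k₁ u + t * k₁ w = 0 := by simpa using congrArg k₁ hst
    have h2 : s * k₂ u + t * k₂ w = 0 := by simpa using congrArg k₂ hst
    constructor
    · have : s * (k₁ u * k₂ w - k₁ w * k₂ u) = 0 := by linear_combination k₂ w * h1 - k₁ w * h2
      exact (mul_eq_zero.1 this).resolve_right h
    · have : t * (k₁ u * k₂ w - k₁ w * k₂ u) = 0 := by linear_combination k₁ u * h2 - k₂ u * h1
      exact (mul_eq_zero.1 this).resolve_right h
  have hs := hli.span_eq_top_of_card_eq_finrank (by simp)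
  have hx : x ∈ Submodule.span ℝ (Set.range ![u, w]) := hs ▸ Submodule.mem_top
  rw [Matrix.range_cons, Matrix.range_cons, Matrix.range_empty, Set.union_empty,
    Set.singleton_union, Submodule.mem_span_pair] at hx
  obtain ⟨p, q, h⟩ := hx
  exact ⟨p, q, h.symm⟩

theorem eq_of_linearMap_eq {k₁ k₂ : Plane →ₗ[ℝ] ℝ} {u w : Plane}
    (h : k₁ u * k₂ w - k₁ w * k₂ u ≠ 0) {x y : Plane} (h1 : k₁ x = k₁ y) (h2 : k₂ x = k₂ y) :
    x = y := by
  obtain ⟨p, q, hpq⟩ := exists_eq_smul_add_smul h (x - y)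
  have e1 : p * k₁ u + q * k₁ w = 0 := by
    have := congrArg k₁ hpq
    simp only [map_sub, map_add, map_smul, smul_eq_mul, h1, sub_self] at this
    exact this.symm
  have e2 : p * k₂ u + q * k₂ w = 0 := by
    have := congrArg k₂ hpq
    simp only [map_sub, map_add, map_smul, smul_eq_mul, h2, sub_self] at this
    exact this.symm
  have hp : p * (k₁ u * k₂ w - k₁ w * k₂ u) = 0 := by linear_combination k₂ w * e1 - k₁ w * e2
  have hq : q * (k₁ u * k₂ w - k₁ w * k₂ u) = 0 := by linear_combination k₁ u * e2 - k₂ u * e1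
  rw [(mul_eq_zero.1 hp).resolve_right h, (mul_eq_zero.1 hq).resolve_right h] at hpq
  rw [← sub_eq_zero, hpq]; simp

namespace IsSymmVertexSet

variable {V : Set Plane}

theorem exists_notMem (hV : IsSymmVertexSet V) (a b c d : Plane) :
    ∃ x ∈ V, x ≠ a ∧ x ≠ b ∧ x ≠ c ∧ x ≠ d := by
  classical
  obtain ⟨x, hx, hx'⟩ := Set.exists_mem_notMem_of_ncard_lt_ncard (s := {a, b, c, d}) (t := V) (by
    refine lt_of_le_of_lt ?_ hV.four_lt
    have : ({a, b, c, d} : Set Plane) = (({a, b, c, d} : Finset Plane) : Set Plane) := by simp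
    rw [this, Set.ncard_coe_finset]
    exact Finset.card_le_four)
  simp only [Set.mem_insert_iff, Set.mem_singleton_iff, not_or] at hx'
  exact ⟨x, hx, hx'⟩

/-- Among three collinear points one lies between the other two, contradicting convex position. -/
theorem false_of_collinear (hV : IsSymmVertexSet V) {k : Plane →ₗ[ℝ] ℝ} (hk : k ≠ 0)
    {x y z : Plane} (hx : x ∈ V) (hy : y ∈ V) (hz : z ∈ V) (hxy : x ≠ y) (hyz : y ≠ z)
    (hxz : x ≠ z) (h1 : k y = k x) (h2 : k z = k x) : False := by
  have key : ∀ {a b c : Plane}, a ∈ V → b ∈ V → c ∈ V → a ≠ b → b ≠ c → Wbtw ℝ a b c → False := by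
    intro a b c ha hb hc hab hbc h
    rw [← mem_segment_iff_wbtw] at h
    have ha' : a ∈ V \ {b} := ⟨ha, hab⟩
    have hc' : c ∈ V \ {b} := ⟨hc, hbc.symm⟩
    exact hV.notMem_convexHull b hb ((convex_convexHull ℝ _).segment_subset
      (subset_convexHull ℝ _ ha') (subset_convexHull ℝ _ hc') h)
  rcases (collinear_of_linearMap_eq hk h1 h2).wbtw_or_wbtw_or_wbtw with h | h | h
  · exact key hx hy hz hxy hyz h
  · exact key hy hz hx hyz hxz.symm h
  · exact key hz hx hy hxz.symm hxy h

/-- If the maximum k v were 0, symmetry would force k = 0 on all of V, putting V on one line.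
Strictness off the edge holds because no three vertices are collinear. -/
theorem isEdgeFunctional_smul (hV : IsSymmVertexSet V) {k : Plane →ₗ[ℝ] ℝ} (hk : k ≠ 0)
    {u v : Plane} (hu : u ∈ V) (hv : v ∈ V) (huv : u ≠ v) (h : k u = k v)
    (hle : ∀ x ∈ V, k x ≤ k v) : IsEdgeFunctional V ((k v)⁻¹ • k) u v := by
  have h0 : 0 ≤ k v := by
    have := hle _ (hV.neg_mem v hv)
    rw [map_neg] at this
    linarith
  have hpos : 0 < k v := by
    refine lt_of_le_of_ne h0 fun h0' => ?_
    obtain ⟨x, hx, hxu, hxv, -⟩ := hV.exists_notMem u v u v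
    have h1 := hle _ hx
    have h2 := hle _ (hV.neg_mem x hx)
    rw [map_neg] at h2
    exact hV.false_of_collinear hk hv hu hx huv.symm hxu.symm hxv.symm h (by linarith)
  refine ⟨hu, hv, huv, ?_, ?_, fun x hx hxu hxv => ?_⟩
  · simp [h, hpos.ne']
  · simp [hpos.ne']
  · have : k x < k v := lt_of_le_of_ne (hle x hx) fun hxk =>
      hV.false_of_collinear hk hv hu hx huv.symm hxu.symm hxv.symm h hxk
    rw [LinearMap.smul_apply, smul_eq_mul, inv_mul_lt_iff₀ hpos, mul_one]
    exact this

/-- Rotate a line supporting V only at v until it first touches another vertex; `s` is the largest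
slope seen from v. -/
theorem exists_max_slope (hV : IsSymmVertexSet V) {v : Plane} {f : Plane →ₗ[ℝ] ℝ}
    (hf : ∀ x ∈ V, x ≠ v → f x < f v) (g : Plane →ₗ[ℝ] ℝ) :
    ∃ u ∈ V, u ≠ v ∧ ∃ s : ℝ, (g + s • f) u = (g + s • f) v ∧
      ∀ x ∈ V, (g + s • f) x ≤ (g + s • f) v := by
  obtain ⟨x₀, hx₀, hx₀v, -⟩ := hV.exists_notMem v v v v
  obtain ⟨u, ⟨hu, huv⟩, hmax⟩ := (hV.finite.subset Set.sdiff_subset : (V \ {v}).Finite).exists_maximalFor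
    (fun x => (g x - g v) / (f v - f x)) _ ⟨x₀, hx₀, hx₀v⟩
  have huv : u ≠ v := huv
  have hpos : ∀ x ∈ V, x ≠ v → 0 < f v - f x := fun x hx hxv => sub_pos.2 (hf x hx hxv)
  refine ⟨u, hu, huv, (g u - g v) / (f v - f u), ?_, fun x hx => ?_⟩
  · have := (hpos u hu huv).ne'
    simp only [LinearMap.add_apply, LinearMap.smul_apply, smul_eq_mul]
    field_simp
    ring
  · by_cases hxv : x = v
    · rw [hxv]
    have hle : (g x - g v) / (f v - f x) ≤ (g u - g v) / (f v - f u) := by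
      by_contra hlt
      exact hlt (hmax ⟨hx, hxv⟩ (not_le.1 hlt).le)
    rw [div_le_iff₀ (hpos x hx hxv)] at hle
    simp only [LinearMap.add_apply, LinearMap.smul_apply, smul_eq_mul]
    linarith

/-- Every vertex has two neighbours. -/
theorem exists_neighbours (hV : IsSymmVertexSet V) {v : Plane} (hv : v ∈ V) :
    ∃ (u w : Plane) (k₁ k₂ : Plane →ₗ[ℝ] ℝ), u ≠ w ∧ IsEdgeFunctional V k₁ u v ∧
      IsEdgeFunctional V k₂ w v := by
  obtain ⟨F, c, hF, hFv⟩ := geometric_hahn_banach_closed_point (convex_convexHull ℝ (V \ {v}))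
    ((hV.finite.subset Set.sdiff_subset).isClosed_convexHull ℝ) (hV.notMem_convexHull v hv)
  set f : Plane →ₗ[ℝ] ℝ := F.toLinearMap with hfdef
  have hf : ∀ x ∈ V, x ≠ v → f x < f v := fun x hx hxv =>
    (hF x (subset_convexHull ℝ _ ⟨hx, hxv⟩)).trans hFv
  have hf0 : f ≠ 0 := fun h => by
    obtain ⟨x, hx, hxv, -⟩ := hV.exists_notMem v v v v
    have := hf x hx hxv
    simp [h] at this
  obtain ⟨g, y, hfy, hgy⟩ := exists_functional_ne_zero_on_ker f hf0
  obtain ⟨u, hu, huv, s, hs, hsle⟩ := hV.exists_max_slope hf g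
  obtain ⟨w, hw, hwv, r, hr, hrle⟩ := hV.exists_max_slope hf (-g)
  have hk1 : g + s • f ≠ 0 := fun h => hgy (by simpa [hfy] using congrArg (fun k => k y) h)
  have hk2 : -g + r • f ≠ 0 := fun h => hgy (by simpa [hfy] using congrArg (fun k => k y) h)
  refine ⟨u, w, _, _, ?_, hV.isEdgeFunctional_smul hk1 hu hv huv hs hsle,
    hV.isEdgeFunctional_smul hk2 hw hv hwv hr hrle⟩
  -- If both rotations ended at the same vertex, the two functionals would be opposite, and V would
  -- lie on one line.
  rintro rfl
  simp only [LinearMap.add_apply, LinearMap.smul_apply, smul_eq_mul, LinearMap.neg_apply] at *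
  have hsr : r = -s := by
    have h1 : (s + r) * (f v - f u) = 0 := by linarith
    have := (mul_eq_zero.1 h1).resolve_right (sub_pos.2 (hf u hu huv)).ne'
    linarith
  subst hsr
  obtain ⟨x, hx, hxu, hxv, -⟩ := hV.exists_notMem u v u v
  have h1 := hsle x hx
  have h2 := hrle x hx
  refine hV.false_of_collinear hk1 hv hu hx huv.symm hxu.symm hxv.symm ?_ ?_
  · simpa using hs
  · simp only [LinearMap.add_apply, LinearMap.smul_apply, smul_eq_mul]
    linarith

/-- The two neighbours of a vertex are not antipodal. -/
theorem ne_neg_of_neighbours (hV : IsSymmVertexSet V) {u v w : Plane} {k₁ k₂ : Plane →ₗ[ℝ] ℝ}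
    (h₁ : IsEdgeFunctional V k₁ u v) (h₂ : IsEdgeFunctional V k₂ w v) : w ≠ -u := by
  rintro rfl
  have hk2u : k₂ u = -1 := by have := h₂.left_eq; rw [map_neg] at this; linarith
  obtain ⟨x, hx, hxu, hxu', hxv, hxv'⟩ := hV.exists_notMem u (-u) v (-v)
  have hnx := hV.neg_mem x hx
  have hn : ∀ {z : Plane}, x ≠ -z → -x ≠ z := fun h h' => h (by rw [← h', neg_neg])
  have a1 := h₁.lt x hx hxu hxv
  have a2 := h₁.lt _ hnx (hn hxu') (hn hxv')
  have b1 := h₂.lt x hx hxu' hxv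
  have b2 := h₂.lt _ hnx (fun h => hxu (neg_injective h)) (hn hxv')
  rw [map_neg] at a2 b2
  set a := k₁ x with ha
  set b := k₂ x with hb
  -- If w = -u, all vertices lie in the parallelogram |k₁|, |k₂| ≤ 1, whose corners are ±u, ±v. A
  -- fifth vertex x is then their bilinear combination.
  have hxe : x = ((1 + a) / 2) • (((1 + b) / 2) • v + ((1 - b) / 2) • u) +
      ((1 - a) / 2) • (((1 + b) / 2) • (-u) + ((1 - b) / 2) • (-v)) := by
    refine eq_of_linearMap_eq (k₁ := k₁) (k₂ := k₂) (u := u) (w := v) ?_ ?_ ?_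
    · rw [h₁.left_eq, h₁.right_eq, h₂.right_eq, hk2u]; norm_num
    · simp only [map_add, map_smul, map_neg, h₁.left_eq, h₁.right_eq, smul_eq_mul, ← ha]; ring
    · simp only [map_add, map_smul, map_neg, hk2u, h₂.right_eq, smul_eq_mul, ← hb]; ring
  have hmem : ∀ {z : Plane}, z ∈ V → x ≠ z → z ∈ convexHull ℝ (V \ {x}) := fun hz hxz =>
    subset_convexHull ℝ _ ⟨hz, fun h => hxz (Set.mem_singleton_iff.1 h).symm⟩
  have hc := convex_convexHull ℝ (V \ {x})
  refine hV.notMem_convexHull x hx ?_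
  have m1 := hc (hmem h₁.right_mem hxv) (hmem h₁.left_mem hxu)
    (show 0 ≤ (1 + b) / 2 by linarith) (show 0 ≤ (1 - b) / 2 by linarith) (by ring)
  have m2 := hc (hmem h₂.left_mem hxu') (hmem (hV.neg_mem _ h₁.right_mem) hxv')
    (show 0 ≤ (1 + b) / 2 by linarith) (show 0 ≤ (1 - b) / 2 by linarith) (by ring)
  have m3 := hc m1 m2
    (show 0 ≤ (1 + a) / 2 by linarith) (show 0 ≤ (1 - a) / 2 by linarith) (by ring)
  rwa [← hxe] at m3

end IsSymmVertexSet

/-! ### Configurations for sliding a vertex -/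

/-- The data of a sliding of the vertex `v` with neighbours `u`, `w`: the level function `l` of the
direction `w - u` and the supporting lines `α = 1`, `β = 1` along the edges next to `[v, w]`
and `[u, v]`. -/
structure IsSlideConfig (V : Set Plane) (u v w : Plane) (l α β : Plane →ₗ[ℝ] ℝ) : Prop where
  u_mem : u ∈ V
  v_mem : v ∈ V
  w_mem : w ∈ V
  span : ∀ x, ∃ p q : ℝ, x = p • u + q • w
  l_u : l u = 1
  l_w : l w = 1
  one_lt_l_v : 1 < l v
  l_lt : ∀ x ∈ V, x ≠ v → x ≠ u → x ≠ w → l x < 1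
  α_w : α w = 1
  α_le : ∀ x ∈ V, α x ≤ 1
  α_v : α v < 1
  α_u : α u < 1
  α_next : ∃ x ∈ V, α x = 1 ∧ x ≠ w ∧ x ≠ v ∧ x ≠ -v
  β_u : β u = 1
  β_le : ∀ x ∈ V, β x ≤ 1
  β_v : β v < 1
  β_w : β w < 1
  β_next : ∃ x ∈ V, β x = 1 ∧ x ≠ u ∧ x ≠ v ∧ x ≠ -v

theorem IsSlideConfig.symm {V : Set Plane} {u v w : Plane} {l α β : Plane →ₗ[ℝ] ℝ}
    (h : IsSlideConfig V u v w l α β) : IsSlideConfig V w v u l β α where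
  u_mem := h.w_mem
  v_mem := h.v_mem
  w_mem := h.u_mem
  span x := by
    obtain ⟨p, q, rfl⟩ := h.span x
    exact ⟨q, p, add_comm _ _⟩
  l_u := h.l_w
  l_w := h.l_u
  one_lt_l_v := h.one_lt_l_v
  l_lt x hx h1 h2 h3 := h.l_lt x hx h1 h3 h2
  α_w := h.β_u
  α_le := h.β_le
  α_v := h.β_v
  α_u := h.β_w
  α_next := h.β_next
  β_u := h.α_w
  β_le := h.α_le
  β_v := h.α_v
  β_w := h.α_u
  β_next := h.α_next

namespace IsSymmVertexSet

variable {V : Set Plane}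

/-- The other neighbour of w is different from -v as well, so it stays fixed during the motion and
the line α = 1 keeps a fixed vertex besides w. -/
theorem exists_next (hV : IsSymmVertexSet V) {v w : Plane} {k : Plane →ₗ[ℝ] ℝ}
    (h : IsEdgeFunctional V k w v) :
    ∃ (x : Plane) (α : Plane →ₗ[ℝ] ℝ), IsEdgeFunctional V α x w ∧ x ≠ v ∧ x ≠ -v := by
  obtain ⟨a, b, α, β, hab, ha, hb⟩ := hV.exists_neighbours h.left_mem
  by_cases hav : a = v
  · exact ⟨b, β, hb, fun hbv => hab (hav.trans hbv.symm), hV.ne_neg_of_neighbours h.symm hb⟩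
  · exact ⟨a, α, ha, hav, hV.ne_neg_of_neighbours h.symm ha⟩

theorem exists_isSlideConfig (hV : IsSymmVertexSet V) :
    ∃ (u v w : Plane) (l α β k₁ k₂ : Plane →ₗ[ℝ] ℝ), IsSlideConfig V u v w l α β ∧
      IsEdgeFunctional V k₁ u v ∧ IsEdgeFunctional V k₂ w v := by
  obtain ⟨v, hv, -⟩ := hV.exists_notMem 0 0 0 0
  obtain ⟨u, w, k₁, k₂, huw, h₁, h₂⟩ := hV.exists_neighbours hv
  obtain ⟨w', α, hα, hwv, hwv'⟩ := hV.exists_next h₂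
  obtain ⟨u', β, hβ, huv, huv'⟩ := hV.exists_next h₁
  have hwu : w ≠ -u := hV.ne_neg_of_neighbours h₁ h₂
  have a1 := h₁.lt w h₂.left_mem huw.symm h₂.ne
  have a2 := h₁.lt (-w) (hV.neg_mem _ h₂.left_mem) (fun h => hwu (by rw [← h, neg_neg]))
    (fun h => by have := h₂.right_eq; rw [← h, map_neg, h₂.left_eq] at this; norm_num at this)
  have b1 := h₂.lt u h₁.left_mem huw h₁.ne
  have b2 := h₂.lt (-u) (hV.neg_mem _ h₁.left_mem) hwu.symm
    (fun h => by have := h₁.right_eq; rw [← h, map_neg, h₁.left_eq] at this; norm_num at this)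
  rw [map_neg] at a2 b2
  have hD : 0 < 1 - k₁ w * k₂ u := by
    rcases le_total 0 (k₁ w) with h | h <;> nlinarith
  have hdet : k₁ u * k₂ w - k₁ w * k₂ u ≠ 0 := by
    rw [h₁.left_eq, h₂.left_eq]; linarith
  have hspan := exists_eq_smul_add_smul hdet
  -- The coefficients solve l u = l w = 1. They give l v - 1 = (1 - k₁ w)(1 - k₂ u) / (1 - k₁ w * k₂
  -- u), which is positive.
  set l : Plane →ₗ[ℝ] ℝ := ((1 - k₂ u) / (1 - k₁ w * k₂ u)) • k₁ +
    ((1 - k₁ w) / (1 - k₁ w * k₂ u)) • k₂ with hl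
  have hlx : ∀ x, l x = ((1 - k₂ u) / (1 - k₁ w * k₂ u)) * k₁ x +
    ((1 - k₁ w) / (1 - k₁ w * k₂ u)) * k₂ x := fun x => by simp [hl]
  have lu : l u = 1 := by
    rw [hlx, h₁.left_eq, mul_one, div_mul_eq_mul_div, ← add_div, div_eq_one_iff_eq hD.ne']; ring
  have lw : l w = 1 := by
    rw [hlx, h₂.left_eq, mul_one, div_mul_eq_mul_div, ← add_div, div_eq_one_iff_eq hD.ne']; ring
  have lv : 1 < l v := by
    rw [hlx, h₁.right_eq, h₂.right_eq, mul_one, mul_one, ← add_div, lt_div_iff₀ hD]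
    nlinarith [mul_pos (sub_pos.2 a1) (sub_pos.2 b1)]
  have l_lt : ∀ x ∈ V, x ≠ v → x ≠ u → x ≠ w → l x < 1 := by
    intro x hx hxv hxu hxw
    by_contra hlx1
    rw [not_lt] at hlx1
    have c1 := h₁.lt x hx hxu hxv
    have c2 := h₂.lt x hx hxw hxv
    have d1 : 0 < 1 - k₁ w := by linarith
    have d2 : 0 < 1 - k₂ u := by linarith
    -- Barycentric coordinates with respect to u, v, w: a further vertex with l x ≥ 1 would lie in
    -- that triangle.
    set P := (1 - k₂ x) / (1 - k₂ u) with hP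
    set R := (1 - k₁ x) / (1 - k₁ w) with hR
    have hP' : P * (1 - k₂ u) = 1 - k₂ x := by rw [hP]; field_simp
    have hR' : R * (1 - k₁ w) = 1 - k₁ x := by rw [hR]; field_simp
    have hxe : x = P • u + (1 - P - R) • v + R • w := by
      refine eq_of_linearMap_eq hdet ?_ ?_
      · simp only [map_add, map_smul, smul_eq_mul, h₁.left_eq, h₁.right_eq]
        linarith
      · simp only [map_add, map_smul, smul_eq_mul, h₂.left_eq, h₂.right_eq]
        linarith
    have hQ : 0 ≤ 1 - P - R := by
      have := congrArg l hxe
      simp only [map_add, map_smul, smul_eq_mul, lu, lw] at this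
      have h3 : l x - 1 = (1 - P - R) * (l v - 1) := by rw [this]; ring
      by_contra hneg
      nlinarith
    refine hV.notMem_convexHull x hx ?_
    have hmem : ∀ {z : Plane}, z ∈ V → x ≠ z → z ∈ convexHull ℝ (V \ {x}) := fun hz hxz =>
      subset_convexHull ℝ _ ⟨hz, fun h => hxz (Set.mem_singleton_iff.1 h).symm⟩
    have h3 := (convex_convexHull ℝ (V \ {x})).sum_mem (t := Finset.univ)
      (w := ![P, 1 - P - R, R]) (z := ![u, v, w]) (by
        intro i _; fin_cases i
        · exact (div_pos (by linarith) d2).le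
        · exact hQ
        · exact (div_pos (by linarith) d1).le) (by simp only [Fin.sum_univ_three]; change P + (1 - P - R) + R = 1; ring) (by
        intro i _; fin_cases i
        · exact hmem h₁.left_mem hxu
        · exact hmem hv hxv
        · exact hmem h₂.left_mem hxw)
    simp only [Fin.sum_univ_three] at h3
    exact hxe ▸ h3
  -- A functional equal to 1 at both u and w is l itself, but l v > 1.
  have not_both : ∀ {γ : Plane →ₗ[ℝ] ℝ}, γ u = 1 → γ w = 1 → γ v < 1 → False := by
    intro γ h1 h2 h3
    obtain ⟨p, q, hpq⟩ := hspan v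
    have e1 := congrArg γ hpq
    have e2 := congrArg l hpq
    simp only [map_add, map_smul, smul_eq_mul, lu, lw, h1, h2] at e1 e2
    linarith
  have αv : α v < 1 := hα.lt v hv hwv.symm h₂.ne.symm
  have βv : β v < 1 := hβ.lt v hv huv.symm h₁.ne.symm
  exact ⟨u, v, w, l, α, β, k₁, k₂,
    { u_mem := h₁.left_mem
      v_mem := hv
      w_mem := h₂.left_mem
      span := hspan
      l_u := lu
      l_w := lw
      one_lt_l_v := lv
      l_lt := l_lt
      α_w := hα.right_eq
      α_le := fun x hx => hα.le_one hx
      α_v := αv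
      α_u := lt_of_le_of_ne (hα.le_one h₁.left_mem) fun h => not_both h hα.right_eq αv
      α_next := ⟨w', hα.left_mem, hα.left_eq, hα.ne, hwv, hwv'⟩
      β_u := hβ.right_eq
      β_le := fun x hx => hβ.le_one hx
      β_v := βv
      β_w := lt_of_le_of_ne (hβ.le_one h₂.left_mem) fun h => not_both hβ.right_eq h βv
      β_next := ⟨u', hβ.left_mem, hβ.left_eq, hβ.ne, huv, huv'⟩ }, h₁, h₂⟩

end IsSymmVertexSet

/-! ### Convex hulls, extreme points and faces -/

theorem neg_mem_convexHull {A : Set Plane} (hA : ∀ x ∈ A, -x ∈ A) {x : Plane}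
    (hx : x ∈ convexHull ℝ A) : -x ∈ convexHull ℝ A := by
  have : -A = A := by
    ext y
    exact ⟨fun h => by simpa using hA _ h, fun h => hA _ h⟩
  rw [← this, convexHull_neg]
  simpa using hx

theorem convexHull_le {A : Set Plane} {k : Plane →ₗ[ℝ] ℝ} {r : ℝ} (h : ∀ x ∈ A, k x ≤ r)
    {x : Plane} (hx : x ∈ convexHull ℝ A) : k x ≤ r :=
  convexHull_min (t := {x | k x ≤ r}) h (convex_halfSpace_le k.isLinear r) hx

theorem convexHull_lt {A : Set Plane} {k : Plane →ₗ[ℝ] ℝ} {r : ℝ} (h : ∀ x ∈ A, k x < r)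
    {x : Plane} (hx : x ∈ convexHull ℝ A) : k x < r :=
  convexHull_min (t := {x | k x < r}) h (convex_halfSpace_lt k.isLinear r) hx

theorem exists_of_mem_convexHull_insert {A : Set Plane} (hA : A.Nonempty) {x z : Plane}
    (hz : z ∈ convexHull ℝ (insert x A)) :
    ∃ y ∈ convexHull ℝ A, ∃ s : ℝ, 0 ≤ s ∧ s ≤ 1 ∧ z = x + s • (y - x) := by
  rw [convexHull_insert hA, mem_convexJoin] at hz
  obtain ⟨x', hx', y, hy, hz⟩ := hz
  rw [Set.mem_singleton_iff] at hx'
  subst hx'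
  rw [segment_eq_image'] at hz
  obtain ⟨s, ⟨h0, h1⟩, rfl⟩ := hz
  exact ⟨y, hy, s, h0, h1, rfl⟩

theorem mem_extremePoints_of_forall_lt {X : Set Plane} {x : Plane} (hx : x ∈ X)
    {k : Plane →ₗ[ℝ] ℝ} (h : ∀ y ∈ X, y ≠ x → k y < k x) :
    x ∈ (convexHull ℝ X).extremePoints ℝ := by
  have key : ∀ y ∈ convexHull ℝ X, y ≠ x → k y < k x := by
    intro y hy hyx
    rcases (X \ {x}).eq_empty_or_nonempty with h0 | h0
    · have hX : X ⊆ {x} := Set.sdiff_eq_empty.1 h0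
      have := convexHull_mono hX hy
      rw [convexHull_singleton] at this
      exact absurd this hyx
    · rw [← Set.insert_eq_of_mem hx, ← Set.insert_sdiff_singleton] at hy
      obtain ⟨z, hz, s, hs0, -, rfl⟩ := exists_of_mem_convexHull_insert h0 hy
      have hzx : k z < k x := convexHull_lt (fun y hy => h y hy.1 hy.2) hz
      have hs : 0 < s := lt_of_le_of_ne hs0 fun h => hyx (by rw [← h]; simp)
      simp only [map_add, map_smul, map_sub, smul_eq_mul]
      nlinarith
  rw [(convex_convexHull ℝ X).mem_extremePoints_iff_mem_sdiff_convexHull_sdiff]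
  refine ⟨subset_convexHull ℝ _ hx, fun hmem => ?_⟩
  exact lt_irrefl _ (convexHull_lt (fun y hy => key y hy.1 hy.2) hmem)

theorem neg_mem_extremePoints {A : Set Plane} (hA : ∀ x ∈ A, -x ∈ A) {x : Plane}
    (hx : x ∈ A.extremePoints ℝ) : -x ∈ A.extremePoints ℝ := by
  refine ⟨hA _ hx.1, fun y hy z hz h => ?_⟩
  have := hx.2 (hA y hy) (hA z hz) (by
    obtain ⟨a, b, ha, hb, hab, h⟩ := h
    refine ⟨a, b, ha, hb, hab, ?_⟩
    rw [smul_neg, smul_neg, ← neg_add, h, neg_neg])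
  rw [← this, neg_neg]

/-- Extremality is a local property. -/
theorem mem_extremePoints_of_strip {A S : Set Plane} (hA : Convex ℝ A) {l : Plane →ₗ[ℝ] ℝ}
    (hAS : ∀ x ∈ A, |l x| < 1 → x ∈ S) {y : Plane} (hyA : y ∈ A) (hy : y ∈ S.extremePoints ℝ)
    (hly : |l y| < 1) : y ∈ A.extremePoints ℝ := by
  refine ⟨hyA, fun x₁ h₁ x₂ h₂ h => ?_⟩
  set M := |l (x₁ - y)| + |l (x₂ - y)| with hM
  have hM1 : |l (x₁ - y)| ≤ M := le_add_of_nonneg_right (abs_nonneg _)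
  have hM2 : |l (x₂ - y)| ≤ M := le_add_of_nonneg_left (abs_nonneg _)
  have hM0 : 0 ≤ M := by positivity
  -- Contracting the segment towards y by the factor δ brings both endpoints into the open strip,
  -- hence into S.
  set δ := (1 - |l y|) / (M + 1) with hδ
  have hδ0 : 0 < δ := div_pos (by linarith) (by linarith)
  have hδ1 : δ ≤ 1 := by
    rw [hδ, div_le_one (by linarith)]
    linarith [abs_nonneg (l y)]
  have hδM : δ * M < 1 - |l y| := by
    have : δ * (M + 1) = 1 - |l y| := by rw [hδ]; field_simp
    linarith
  have key : ∀ x ∈ A, |l (x - y)| ≤ M → y + δ • (x - y) ∈ S := by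
    intro x hx hxM
    refine hAS _ (hA.add_smul_sub_mem hyA hx ⟨hδ0.le, hδ1⟩) ?_
    rw [map_add, map_smul, smul_eq_mul]
    calc _ ≤ |l y| + |δ * l (x - y)| := abs_add_le _ _
      _ = |l y| + δ * |l (x - y)| := by rw [abs_mul, abs_of_pos hδ0]
      _ ≤ |l y| + δ * M := by gcongr
      _ < 1 := by linarith
  have := hy.2 (key x₁ h₁ hM1) (key x₂ h₂ hM2) (by
    obtain ⟨a, b, ha, hb, hab, h⟩ := h
    refine ⟨a, b, ha, hb, hab, ?_⟩
    have e : a • (y + δ • (x₁ - y)) + b • (y + δ • (x₂ - y)) =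
        ((a + b) * (1 - δ)) • y + δ • (a • x₁ + b • x₂) := by module
    rw [e, h, hab]
    module)
  have h2 : δ • (x₁ - y) = 0 := by simpa using this
  rw [smul_eq_zero] at h2
  exact sub_eq_zero.1 (h2.resolve_left hδ0.ne')

theorem IsEdgeFunctional.isEdge {V : Set Plane} {k : Plane →ₗ[ℝ] ℝ} {u v : Plane}
    (h : IsEdgeFunctional V k u v) : IsEdge (convexHull ℝ V) u v := by
  have hle : ∀ x ∈ convexHull ℝ V, k x ≤ 1 := fun x hx => convexHull_le (fun y hy => h.le_one hy) hx
  have face : ∀ x ∈ convexHull ℝ V, k x = 1 → x ∈ segment ℝ u v := by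
    intro x hx hkx
    have hV : V = {u, v} ∪ (V \ {u, v}) :=
      (Set.union_sdiff_cancel (by
        rintro y (rfl | rfl)
        exacts [h.left_mem, h.right_mem])).symm
    rcases (V \ {u, v}).eq_empty_or_nonempty with h0 | h0
    · rwa [hV, h0, Set.union_empty, convexHull_pair] at hx
    · rw [hV, convexHull_union (Set.insert_nonempty _ _) h0, mem_convexJoin] at hx
      obtain ⟨a, ha, b, hb, hx⟩ := hx
      have hka : k a ≤ 1 := hle a (convexHull_mono (by
        rintro y (rfl | rfl)
        exacts [h.left_mem, h.right_mem]) ha)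
      have hkb : k b < 1 := convexHull_lt (fun y hy => by
        have hy2 := hy.2
        simp only [Set.mem_insert_iff, Set.mem_singleton_iff, not_or] at hy2
        exact h.lt y hy.1 hy2.1 hy2.2) hb
      rw [segment_eq_image'] at hx
      obtain ⟨s, ⟨hs0, hs1⟩, rfl⟩ := hx
      simp only [map_add, map_smul, map_sub, smul_eq_mul] at hkx
      have : s = 0 := by
        by_contra hne
        have hs : 0 < s := lt_of_le_of_ne hs0 (Ne.symm hne)
        nlinarith
      rw [convexHull_pair] at ha
      simpa [this] using ha
  refine ⟨h.ne, ⟨(convex_convexHull ℝ V).segment_subset (subset_convexHull ℝ _ h.left_mem)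
    (subset_convexHull ℝ _ h.right_mem), fun x hx y hy z hz hzxy => face x hx ?_⟩⟩
  have hkz : k z = 1 := by
    obtain ⟨a, b, -, -, hab, rfl⟩ := hz
    simp [h.left_eq, h.right_eq, hab]
  obtain ⟨a, b, ha, hb, hab, rfl⟩ := hzxy
  simp only [map_add, map_smul, smul_eq_mul] at hkz
  have h1 := hle x hx
  have h2 := hle y hy
  nlinarith

/-! ### The sliding motion as a shear -/

namespace IsSlideConfig

variable {V : Set Plane} {u v w : Plane} {l α β : Plane →ₗ[ℝ] ℝ}

theorem l_sub (h : IsSlideConfig V u v w l α β) : l (w - u) = 0 := by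
  rw [map_sub, h.l_u, h.l_w, sub_self]

theorem l_le (h : IsSlideConfig V u v w l α β) {x : Plane} (hx : x ∈ V) (hxv : x ≠ v) :
    l x ≤ 1 := by
  by_cases h1 : x = u
  · exact h1 ▸ h.l_u.le
  by_cases h2 : x = w
  · exact h2 ▸ h.l_w.le
  exact (h.l_lt x hx hxv h1 h2).le

theorem mem_segment (h : IsSlideConfig V u v w l α β) {x : Plane} (hl : l x = 1) (hα : α x ≤ 1)
    (hβ : β x ≤ 1) : x ∈ segment ℝ u w := by
  obtain ⟨p, q, rfl⟩ := h.span x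
  have h1 := h.α_u
  have h2 := h.β_w
  simp only [map_add, map_smul, smul_eq_mul, h.l_u, h.l_w, h.α_w, h.β_u] at *
  have hq : q = 1 - p := by linarith
  subst hq
  refine ⟨p, 1 - p, ?_, ?_, by ring, rfl⟩
  · by_contra hneg
    nlinarith
  · by_contra hneg
    nlinarith

/-- A segment from x down to A crosses the line l = 1 where α, β ≤ 1, that is, inside [u, w]. The
hull is thereby cut into a triangle over the chord and a part of A. -/
theorem cut (h : IsSlideConfig V u v w l α β) {A : Set Plane} (hA : Convex ℝ A)
    (hAn : A.Nonempty) (hle : ∀ a ∈ A, l a ≤ 1 ∧ α a ≤ 1 ∧ β a ≤ 1) {x z : Plane} (hlx : 1 < l x)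
    (hαx : α x ≤ 1) (hβx : β x ≤ 1) (hz : z ∈ convexHull ℝ (insert x A)) :
    (1 ≤ l z → z ∈ convexHull ℝ {u, x, w}) ∧ (l z ≤ 1 → segment ℝ u w ⊆ A → z ∈ A) := by
  obtain ⟨a, ha, s, hs0, hs1, rfl⟩ := exists_of_mem_convexHull_insert hAn hz
  rw [hA.convexHull_eq] at ha
  obtain ⟨hla, hαa, hβa⟩ := hle a ha
  have hpos : 0 < l x - l a := by linarith
  set τ := (l x - 1) / (l x - l a) with hτ
  have hτ0 : 0 < τ := div_pos (by linarith) hpos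
  have hτ1 : τ ≤ 1 := by rw [hτ, div_le_one hpos]; linarith
  have hτe : τ * (l x - l a) = l x - 1 := by rw [hτ]; field_simp
  have hc : x + τ • (a - x) ∈ segment ℝ u w := by
    refine h.mem_segment ?_ ?_ ?_
    · simp only [map_add, map_smul, map_sub, smul_eq_mul]; linarith
    · simp only [map_add, map_smul, map_sub, smul_eq_mul]; nlinarith
    · simp only [map_add, map_smul, map_sub, smul_eq_mul]; nlinarith
  have hlz : l (x + s • (a - x)) = l x - s * (l x - l a) := by
    simp only [map_add, map_smul, map_sub, smul_eq_mul]; ring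
  rw [hlz]
  constructor
  · intro h1
    have hsτ : s ≤ τ := by
      by_contra hlt
      nlinarith
    have hmem : x + τ • (a - x) ∈ convexHull ℝ {u, x, w} :=
      (convex_convexHull ℝ _).segment_subset (subset_convexHull ℝ _ (by simp))
        (subset_convexHull ℝ _ (by simp)) hc
    have hx : x ∈ convexHull ℝ {u, x, w} := subset_convexHull ℝ _ (by simp)
    have := (convex_convexHull ℝ {u, x, w}).add_smul_sub_mem hx hmem
      (t := s / τ) ⟨by positivity, (div_le_one hτ0).2 hsτ⟩
    rwa [add_sub_cancel_left, smul_smul, div_mul_cancel₀ _ hτ0.ne'] at this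
  · intro h1 hseg
    have hsτ : τ ≤ s := by
      by_contra hlt
      nlinarith
    rcases eq_or_lt_of_le hτ1 with h2 | h2
    · have : s = 1 := le_antisymm hs1 (h2 ▸ hsτ)
      simpa [this] using ha
    · have hd : 0 < 1 - τ := by linarith
      have := hA.add_smul_sub_mem (hseg hc) ha (t := (s - τ) / (1 - τ))
        ⟨div_nonneg (by linarith) hd.le, (div_le_one hd).2 (by linarith)⟩
      convert this using 1
      have e : a - (x + τ • (a - x)) = (1 - τ) • (a - x) := by module
      rw [e, smul_smul, div_mul_cancel₀ _ hd.ne']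
      module

end IsSlideConfig

/-- The odd profile of the shear realizing a sliding: zero on `[-1, 1]`, affine outside, with
value `1` at `η`. -/
noncomputable def slideProfile (η r : ℝ) : ℝ := (max (r - 1) 0 - max (-r - 1) 0) / (η - 1)

theorem continuous_slideProfile (η : ℝ) : Continuous (slideProfile η) := by
  unfold slideProfile
  fun_prop

theorem slideProfile_neg (η r : ℝ) : slideProfile η (-r) = -slideProfile η r := by
  rw [slideProfile, slideProfile, neg_neg, ← neg_div, neg_sub]

theorem slideProfile_of_abs_le {η r : ℝ} (h : |r| ≤ 1) : slideProfile η r = 0 := by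
  rw [abs_le] at h
  rw [slideProfile, max_eq_right (by linarith), max_eq_right (by linarith), sub_zero, zero_div]

theorem slideProfile_of_one_le {η r : ℝ} (h : 1 ≤ r) : slideProfile η r = (r - 1) / (η - 1) := by
  rw [slideProfile, max_eq_left (by linarith), max_eq_right (by linarith), sub_zero]

/-- The polygon with vertex set `V` in which `±v` have been replaced by `±x`. -/
def replaceVertex (V : Set Plane) (v x : Plane) : Set Plane :=
  convexHull ℝ ((V \ {v, -v}) ∪ {x, -x})

/-- The supporting lines at the ends of the chord `[u, w]` are respected by `x`. -/
structure IsAdmissible (α β : Plane →ₗ[ℝ] ℝ) (x : Plane) : Prop where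
  α_le : α x ≤ 1
  β_le : β x ≤ 1
  le_α : -1 ≤ α x
  le_β : -1 ≤ β x

namespace IsSlideConfig

variable {V : Set Plane} {u v w : Plane} {l α β : Plane →ₗ[ℝ] ℝ}

theorem neg_mem_core (hV : IsSymmVertexSet V) {x : Plane} (hx : x ∈ V \ {v, -v}) :
    -x ∈ V \ {v, -v} := by
  refine ⟨hV.neg_mem x hx.1, ?_⟩
  rintro (h | h)
  · exact hx.2 (Or.inr (by rw [Set.mem_singleton_iff, ← h, neg_neg]))
  · exact hx.2 (Or.inl (neg_injective h))

theorem neg_mem_replaceVertex (hV : IsSymmVertexSet V) {x z : Plane}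
    (hz : z ∈ replaceVertex V v x) : -z ∈ replaceVertex V v x := by
  refine neg_mem_convexHull ?_ hz
  rintro y (hy | rfl | hy)
  · exact Or.inl (neg_mem_core hV hy)
  · exact Or.inr (Or.inr rfl)
  · rw [Set.mem_singleton_iff] at hy
    exact Or.inr (Or.inl (by rw [hy, neg_neg]))

theorem u_mem_core (h : IsSlideConfig V u v w l α β) : u ∈ V \ {v, -v} := by
  have h1 := h.one_lt_l_v
  refine ⟨h.u_mem, ?_⟩
  rintro (h2 | h2)
  · rw [← h2, h.l_u] at h1; exact lt_irrefl _ h1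
  · have := h.l_u
    rw [Set.mem_singleton_iff.1 h2, map_neg] at this
    linarith

theorem w_mem_core (h : IsSlideConfig V u v w l α β) : w ∈ V \ {v, -v} := h.symm.u_mem_core

theorem segment_subset_core (h : IsSlideConfig V u v w l α β) :
    segment ℝ u w ⊆ convexHull ℝ (V \ {v, -v}) :=
  (convex_convexHull ℝ _).segment_subset (subset_convexHull ℝ _ h.u_mem_core)
    (subset_convexHull ℝ _ h.w_mem_core)

theorem core_le (h : IsSlideConfig V u v w l α β) {a : Plane}
    (ha : a ∈ convexHull ℝ (V \ {v, -v})) : l a ≤ 1 ∧ α a ≤ 1 ∧ β a ≤ 1 :=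
  ⟨convexHull_le (fun _ hx => h.l_le hx.1 fun h' => hx.2 (Or.inl h')) ha,
    convexHull_le (fun x hx => h.α_le x hx.1) ha, convexHull_le (fun x hx => h.β_le x hx.1) ha⟩

/-- The caps at x and -x are cut off in turn by `cut`, leaving the hull of the fixed vertices as the
part in |l| ≤ 1. -/
theorem mem_of_mem_replaceVertex (h : IsSlideConfig V u v w l α β) (hV : IsSymmVertexSet V)
    {x z : Plane} (hx : IsAdmissible α β x) (hlx : 1 < l x) (hz : z ∈ replaceVertex V v x) :
    (1 ≤ l z → z ∈ convexHull ℝ {u, x, w}) ∧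
      (|l z| ≤ 1 → z ∈ convexHull ℝ (V \ {v, -v})) := by
  set C := convexHull ℝ (V \ {v, -v}) with hC
  have hCn : C.Nonempty := ⟨u, subset_convexHull ℝ _ h.u_mem_core⟩
  set B := convexHull ℝ (insert (-x) C) with hB
  have hCB : C ⊆ B := (Set.subset_insert _ _).trans (subset_convexHull ℝ _)
  have hBle : ∀ b ∈ B, l b ≤ 1 ∧ α b ≤ 1 ∧ β b ≤ 1 := by
    intro b hb
    refine ⟨convexHull_le ?_ hb, convexHull_le ?_ hb, convexHull_le ?_ hb⟩
    · rintro y (rfl | hy)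
      · rw [map_neg]; linarith
      · exact (h.core_le hy).1
    · rintro y (rfl | hy)
      · rw [map_neg]; linarith [hx.le_α]
      · exact (h.core_le hy).2.1
    · rintro y (rfl | hy)
      · rw [map_neg]; linarith [hx.le_β]
      · exact (h.core_le hy).2.2
  have hzB : z ∈ convexHull ℝ (insert x B) := by
    refine convexHull_min ?_ (convex_convexHull ℝ _) hz
    rintro y (hy | rfl | hy)
    · exact subset_convexHull ℝ _ (Or.inr (hCB (subset_convexHull ℝ _ hy)))
    · exact subset_convexHull ℝ _ (Or.inl rfl)
    · rw [Set.mem_singleton_iff.1 hy]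
      exact subset_convexHull ℝ _ (Or.inr (subset_convexHull ℝ _ (Or.inl rfl)))
  have cutB := h.cut (convex_convexHull ℝ _) (hCn.mono hCB) hBle hlx hx.α_le hx.β_le hzB
  refine ⟨cutB.1, fun hlz => ?_⟩
  rw [abs_le] at hlz
  have hzB' : z ∈ B := cutB.2 hlz.2 (h.segment_subset_core.trans hCB)
  have hCneg : ∀ y ∈ C, -y ∈ C := fun y hy => neg_mem_convexHull (fun _ => neg_mem_core hV) hy
  have hnz : -z ∈ convexHull ℝ (insert x C) := by
    have : -(insert (-x) C) = insert x C := by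
      ext y
      simp only [Set.mem_neg, Set.mem_insert_iff, neg_inj]
      refine or_congr Iff.rfl ⟨fun hy => by simpa using hCneg _ hy, hCneg y⟩
    rw [← this, convexHull_neg]
    simpa using hzB'
  have cutC := h.cut (convex_convexHull ℝ _) hCn (fun a ha => h.core_le ha) hlx hx.α_le hx.β_le hnz
  have := cutC.2 (by rw [map_neg]; linarith) h.segment_subset_core
  simpa using hCneg _ this

theorem l_slide (h : IsSlideConfig V u v w l α β) (x : Plane) (t : ℝ) :
    l (x + t • (w - u)) = l x := by
  rw [map_add, map_smul, h.l_sub, smul_zero, add_zero]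

/-- The shear maps the slid polygons to each other. -/
theorem shear_mem (h : IsSlideConfig V u v w l α β) (hV : IsSymmVertexSet V) {t s : ℝ}
    (ht : IsAdmissible α β (v + t • (w - u))) {z : Plane}
    (hz : z ∈ replaceVertex V v (v + t • (w - u))) :
    z + (s * slideProfile (l v) (l z)) • (w - u) ∈ replaceVertex V v (v + (t + s) • (w - u)) := by
  have hη := h.one_lt_l_v
  have hlx : 1 < l (v + t • (w - u)) := by rwa [h.l_slide]
  set P := replaceVertex V v (v + (t + s) • (w - u)) with hP
  have hPc : Convex ℝ P := convex_convexHull ℝ _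
  have hcore : convexHull ℝ (V \ {v, -v}) ⊆ P := convexHull_mono Set.subset_union_left
  have top : ∀ z ∈ replaceVertex V v (v + t • (w - u)), 1 ≤ l z →
      z + (s * slideProfile (l v) (l z)) • (w - u) ∈ P := by
    intro z hz hlz
    have hz' := (h.mem_of_mem_replaceVertex hV ht hlx hz).1 hlz
    rw [slideProfile_of_one_le hlz]
    -- On the cap the map is affine, so it suffices to check the corners: u and w are fixed and the
    -- apex moves by s(w - u).
    refine convexHull_min (t := {y | y + (s * ((l y - 1) / (l v - 1))) • (w - u) ∈ P})
      ?_ ?_ hz'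
    · rintro y (rfl | rfl | rfl)
      · simpa [h.l_u] using hcore (subset_convexHull ℝ _ h.u_mem_core)
      · have e : (l v - 1) / (l v - 1) = 1 := div_self (by linarith)
        rw [Set.mem_ofPred_eq, h.l_slide, e, mul_one, add_assoc, ← add_smul]
        exact subset_convexHull ℝ _ (Or.inr (Or.inl rfl))
      · simpa [h.l_w] using hcore (subset_convexHull ℝ _ h.w_mem_core)
    · intro y₁ h₁ y₂ h₂ a b ha hb hab
      have := hPc h₁ h₂ ha hb hab
      rw [Set.mem_ofPred_eq]
      convert this using 1
      have hb' : b = 1 - a := by linarith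
      subst hb'
      simp only [map_add, map_smul, smul_eq_mul]
      module
  rcases le_total 1 (l z) with h1 | h1
  · exact top z hz h1
  rcases le_total (l z) (-1) with h2 | h2
  · have := top (-z) (neg_mem_replaceVertex hV hz) (by rw [map_neg]; linarith)
    have := neg_mem_replaceVertex hV this
    rw [map_neg, slideProfile_neg] at this
    convert this using 1
    module
  · have habs : |l z| ≤ 1 := abs_le.2 ⟨h2, h1⟩
    rw [slideProfile_of_abs_le habs, mul_zero, zero_smul, add_zero]
    exact hcore ((h.mem_of_mem_replaceVertex hV ht hlx hz).2 habs)

theorem replaceVertex_zero (hV : IsSymmVertexSet V) (hv : v ∈ V) :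
    replaceVertex V v v = convexHull ℝ V := by
  rw [replaceVertex, Set.sdiff_union_of_subset]
  rintro x (rfl | hx)
  · exact hv
  · exact Set.mem_singleton_iff.1 hx ▸ hV.neg_mem v hv

theorem neg_one_le (hV : IsSymmVertexSet V) {k : Plane →ₗ[ℝ] ℝ} (hk : ∀ x ∈ V, k x ≤ 1)
    {x : Plane} (hx : x ∈ V) : -1 ≤ k x := by
  have := hk _ (hV.neg_mem x hx)
  rw [map_neg] at this
  linarith

/-- The shears at times s and -s are mutually inverse, since l is constant along w - u; `shear_mem`
is used in both directions. -/
theorem shear_preimage (h : IsSlideConfig V u v w l α β) (hV : IsSymmVertexSet V) {s : ℝ}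
    (hs : IsAdmissible α β (v + s • (w - u))) :
    (fun x => x + (s * slideProfile (l v) (l x)) • (w - u)) ⁻¹'
      replaceVertex V v (v + s • (w - u)) = convexHull ℝ V := by
  ext x
  rw [Set.mem_preimage, ← replaceVertex_zero hV h.v_mem]
  constructor
  · intro hx
    have := h.shear_mem hV (s := -s) hs hx
    rw [h.l_slide, add_neg_cancel, zero_smul, add_zero, neg_mul, neg_smul,
      add_neg_cancel_right] at this
    exact this
  · intro hx
    have hadm : IsAdmissible α β (v + (0 : ℝ) • (w - u)) := by
      rw [zero_smul, add_zero]
      exact ⟨h.α_v.le, h.β_v.le, neg_one_le hV h.α_le h.v_mem, neg_one_le hV h.β_le h.v_mem⟩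
    have := h.shear_mem hV (t := 0) (s := s) hadm (by simpa using hx)
    rwa [zero_add] at this

/-- The time at which the slid vertex reaches the line `α = 1`. -/
noncomputable def slideTime (u v : Plane) (α : Plane →ₗ[ℝ] ℝ) : ℝ := (1 - α v) / (1 - α u)

theorem slideTime_pos (h : IsSlideConfig V u v w l α β) : 0 < slideTime u v α :=
  div_pos (sub_pos.2 h.α_v) (sub_pos.2 h.α_u)

theorem α_slideTime (h : IsSlideConfig V u v w l α β) :
    α (v + slideTime u v α • (w - u)) = 1 := by
  have := (sub_pos.2 h.α_u).ne'
  simp only [map_add, map_smul, map_sub, smul_eq_mul, h.α_w, slideTime]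
  field_simp
  ring

/-- Guarantees that the moving vertex does not cross the line β = -1 through -u before reaching α =
1. At that time x = pu + qw with p > 0, so β x = β w + p(1 - α u * β w) ≥ -1. -/
theorem le_β_slideTime (h : IsSlideConfig V u v w l α β) (hV : IsSymmVertexSet V) :
    -1 ≤ β (v + slideTime u v α • (w - u)) := by
  have h1 := h.α_slideTime
  have h2 : 1 < l (v + slideTime u v α • (w - u)) := by rw [h.l_slide]; exact h.one_lt_l_v
  generalize v + slideTime u v α • (w - u) = x at *
  obtain ⟨p, q, rfl⟩ := h.span x
  have a1 := h.α_u
  have a2 := neg_one_le hV h.α_le h.u_mem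
  have b1 := h.β_w
  have b2 := neg_one_le hV h.β_le h.w_mem
  simp only [map_add, map_smul, smul_eq_mul, h.l_u, h.l_w, h.α_w, h.β_u] at *
  have hp : 0 < p := by
    by_contra hneg
    nlinarith
  have hq : q = 1 - p * α u := by linarith
  subst hq
  have h3 : α u * β w ≤ 1 := by
    rcases le_total 0 (β w) with h4 | h4 <;> nlinarith
  nlinarith [mul_nonneg hp.le (sub_nonneg.2 h3)]

theorem isAdmissible (h : IsSlideConfig V u v w l α β) (hV : IsSymmVertexSet V) {t : ℝ}
    (h0 : 0 ≤ t) (ht : t ≤ slideTime u v α) : IsAdmissible α β (v + t • (w - u)) := by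
  have h1 := h.α_slideTime
  have h2 := h.le_β_slideTime hV
  have a1 := h.α_u
  have b1 := h.β_w
  have a2 := neg_one_le hV h.α_le h.v_mem
  have b2 := h.β_v
  simp only [map_add, map_smul, map_sub, smul_eq_mul, h.α_w, h.β_u] at h1 h2
  constructor <;> simp only [map_add, map_smul, map_sub, smul_eq_mul, h.α_w, h.β_u] <;> nlinarith

end IsSlideConfig

/-! ### The end of the motion: one antipodal pair of vertices is lost -/

namespace IsSlideConfig

variable {V : Set Plane} {u v w : Plane} {l α β : Plane →ₗ[ℝ] ℝ}

/-- At the end of the motion `w` is no longer a vertex. -/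
theorem replaceVertex_slideTime (h : IsSlideConfig V u v w l α β) (hV : IsSymmVertexSet V)
    {x : Plane} (hx : x = v + slideTime u v α • (w - u)) :
    replaceVertex V v x = convexHull ℝ ((V \ {v, -v, w, -w}) ∪ {x, -x}) := by
  have hlv := h.one_lt_l_v
  have hαx : α x = 1 := hx ▸ h.α_slideTime
  have hlx : l x = l v := by rw [hx, h.l_slide]
  set X := (V \ {v, -v, w, -w}) ∪ {x, -x} with hX
  have hXneg : ∀ y ∈ X, -y ∈ X := by
    rintro y (⟨hy, hy'⟩ | rfl | hy)
    · refine Or.inl ⟨hV.neg_mem y hy, fun h' => hy' ?_⟩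
      simp only [Set.mem_insert_iff, Set.mem_singleton_iff, neg_eq_iff_eq_neg,
        neg_neg] at h' ⊢
      tauto
    · exact Or.inr (Or.inr rfl)
    · rw [Set.mem_singleton_iff] at hy
      exact Or.inr (Or.inl (by rw [hy, neg_neg]))
  -- On the line α = 1, w lies between the next vertex w' and the moved vertex x, because l w' < 1 <
  -- l x.
  have hw : w ∈ convexHull ℝ X := by
    obtain ⟨w', hw', hαw', h1, h2, h3⟩ := h.α_next
    have hne : w' ≠ u := fun h' => by have := h.α_u; rw [← h', hαw'] at this; exact lt_irrefl _ this
    have hne' : w' ≠ -w := fun h' => by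
      rw [h', map_neg, h.α_w] at hαw'; norm_num at hαw'
    have hlw' := h.l_lt w' hw' h2 hne h1
    have hmem : w' ∈ X := Or.inl ⟨hw', by simp [h1, h2, h3, hne']⟩
    have hd : 0 < l v - l w' := by linarith
    have := (convex_convexHull ℝ X).add_smul_sub_mem (subset_convexHull ℝ _ hmem)
      (subset_convexHull ℝ _ (Or.inr (Or.inl rfl))) (t := (1 - l w') / (l v - l w'))
      ⟨div_nonneg (by linarith) hd.le, (div_le_one hd).2 (by linarith)⟩
    convert this using 1
    refine eq_of_linearMap_eq (k₁ := α) (k₂ := l) (u := u) (w := w) ?_ ?_ ?_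
    · rw [h.l_w, h.α_w, h.l_u]
      linarith [h.α_u]
    · simp only [map_add, map_smul, map_sub, smul_eq_mul, hαx, hαw', h.α_w]; ring
    · simp only [map_add, map_smul, map_sub, smul_eq_mul, hlx, h.l_w]
      field_simp
      ring
  refine Set.Subset.antisymm (convexHull_min ?_ (convex_convexHull ℝ _)) (convexHull_mono ?_)
  · rintro y (⟨hy, hy'⟩ | hy)
    · by_cases hyw : y = w
      · exact hyw ▸ hw
      by_cases hyw' : y = -w
      · exact hyw' ▸ neg_mem_convexHull hXneg hw
      · refine subset_convexHull ℝ _ (Or.inl ⟨hy, ?_⟩)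
        simp only [Set.mem_insert_iff, Set.mem_singleton_iff, not_or] at hy' ⊢
        exact ⟨hy'.1, hy'.2, hyw, hyw'⟩
    · exact subset_convexHull ℝ _ (Or.inr hy)
  · refine Set.union_subset_union_left _ (Set.sdiff_subset_sdiff_right ?_)
    rintro y (rfl | hy)
    · simp
    · simp [Set.mem_singleton_iff.1 hy]

/-- The vertex x is exposed by l and u by a tilt of β; symmetry gives -x and -u. All others lie in
the open strip |l| < 1, where the new polygon is contained in the old one, so they remain extreme.
-/
theorem extremePoints_replaceVertex_slideTime (h : IsSlideConfig V u v w l α β)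
    (hV : IsSymmVertexSet V) (hVe : (convexHull ℝ V).extremePoints ℝ = V)
    {x : Plane} (hx : x = v + slideTime u v α • (w - u)) :
    (replaceVertex V v x).extremePoints ℝ = (V \ {v, -v, w, -w}) ∪ {x, -x} := by
  have hlv := h.one_lt_l_v
  have hlx : l x = l v := by rw [hx, h.l_slide]
  have hadm : IsAdmissible α β x := hx ▸ h.isAdmissible hV h.slideTime_pos.le le_rfl
  have hβx : β x < 1 := by
    rw [hx]
    have h1 := h.slideTime_pos
    have h2 := h.β_w
    have h3 := h.β_v
    simp only [map_add, map_smul, map_sub, smul_eq_mul, h.β_u]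
    nlinarith
  have heq := h.replaceVertex_slideTime hV hx
  have hneg : ∀ {y}, y ∈ (replaceVertex V v x).extremePoints ℝ →
      -y ∈ (replaceVertex V v x).extremePoints ℝ := fun hy =>
    neg_mem_extremePoints (fun z hz => neg_mem_replaceVertex hV hz) hy
  refine Set.Subset.antisymm (heq ▸ extremePoints_convexHull_subset) ?_
  have hxe : x ∈ (replaceVertex V v x).extremePoints ℝ := by
    rw [heq]
    refine mem_extremePoints_of_forall_lt (k := l) (Or.inr (Or.inl rfl)) ?_
    rintro y (⟨hy, hy'⟩ | rfl | hy) hyx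
    · rw [hlx]
      exact (h.l_le hy fun h' => hy' (Or.inl h')).trans_lt hlv
    · exact absurd rfl hyx
    · rw [Set.mem_singleton_iff.1 hy, map_neg, hlx]; linarith
  have hu : u ∈ V \ {v, -v, w, -w} := by
    have h1 := h.u_mem_core.2
    simp only [Set.mem_insert_iff, Set.mem_singleton_iff, not_or] at h1
    refine ⟨h.u_mem, ?_⟩
    simp only [Set.mem_insert_iff, Set.mem_singleton_iff, not_or]
    refine ⟨h1.1, h1.2, fun h' => ?_, fun h' => ?_⟩
    · have := h.α_u; rw [h', h.α_w] at this; exact lt_irrefl _ this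
    · have := h.l_u; rw [h', map_neg, h.l_w] at this; norm_num at this
  have hue : u ∈ (replaceVertex V v x).extremePoints ℝ := by
    rw [heq]
    -- Adding a multiple of l separates u from the rest of its edge on β = 1; ε is small enough that
    -- x, where l is larger but β < 1, stays below.
    have hε : 0 < (1 - β x) / (2 * (l v - 1)) := div_pos (by linarith) (by linarith)
    have hεe : (1 - β x) / (2 * (l v - 1)) * (l v - 1) = (1 - β x) / 2 := by
      have : l v - 1 ≠ 0 := by linarith
      field_simp
    set ε := (1 - β x) / (2 * (l v - 1))
    refine mem_extremePoints_of_forall_lt (k := β + ε • l) (Or.inl hu) ?_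
    simp only [LinearMap.add_apply, LinearMap.smul_apply, smul_eq_mul, h.β_u, h.l_u]
    rintro y (⟨hy, hy'⟩ | rfl | hy) hyu
    · simp only [Set.mem_insert_iff, Set.mem_singleton_iff, not_or] at hy'
      have h1 := h.l_lt y hy hy'.1 hyu hy'.2.2.1
      have h2 := h.β_le y hy
      nlinarith
    · rw [hlx]; linarith
    · rw [Set.mem_singleton_iff.1 hy, map_neg, map_neg, hlx]
      nlinarith [hadm.le_β]
  rintro y (⟨hy, hy'⟩ | rfl | hy)
  · by_cases hyu : y = u
    · exact hyu ▸ hue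
    by_cases hyu' : y = -u
    · exact hyu' ▸ hneg hue
    simp only [Set.mem_insert_iff, Set.mem_singleton_iff, not_or] at hy'
    have h1 := h.l_lt y hy hy'.1 hyu hy'.2.2.1
    have h2 := h.l_lt (-y) (hV.neg_mem y hy) (fun e => hy'.2.1 (by rw [← e, neg_neg]))
      (fun e => hyu' (by rw [← e, neg_neg])) (fun e => hy'.2.2.2 (by rw [← e, neg_neg]))
    rw [map_neg] at h2
    refine mem_extremePoints_of_strip (S := convexHull ℝ V) (convex_convexHull ℝ _) (l := l)
      (fun z hz hlz => ?_) ?_ (by rw [hVe]; exact hy) (abs_lt.2 ⟨by linarith, h1⟩)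
    · exact convexHull_mono Set.sdiff_subset
        ((h.mem_of_mem_replaceVertex hV hadm (by rwa [hlx]) hz).2 hlz.le)
    · refine subset_convexHull ℝ _ (Or.inl ⟨hy, ?_⟩)
      simp [hy'.1, hy'.2.1]
  · exact hxe
  · exact Set.mem_singleton_iff.1 hy ▸ hneg hxe

/-- The four vertices ±v, ±w are exchanged for ±x. These are new, since v is the only vertex with l
> 1. -/
theorem isSymmetricPolygon_slideTime (h : IsSlideConfig V u v w l α β)
    (hV : IsSymmVertexSet V) (hVe : (convexHull ℝ V).extremePoints ℝ = V) :
    IsSymmetricPolygon (replaceVertex V v (v + slideTime u v α • (w - u))) (V.ncard - 2) := by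
  obtain ⟨x, hx⟩ : ∃ x, x = v + slideTime u v α • (w - u) := ⟨_, rfl⟩
  rw [← hx]
  have hlv := h.one_lt_l_v
  have hlx : l x = l v := by rw [hx, h.l_slide]
  have hxv : x ≠ v := fun e => by
    have h1 := h.α_v
    rw [← e, hx, h.α_slideTime] at h1
    exact lt_irrefl _ h1
  have hxV : x ∉ V := fun hxV => by
    have := h.l_le hxV hxv
    linarith
  have ne_neg : ∀ {y z : Plane}, 0 < l y → 0 < l z → y ≠ -z := fun h1 h2 e => by
    rw [e, map_neg] at h1; linarith
  have hvw : v ≠ w := fun e => by rw [e, h.l_w] at hlv; exact lt_irrefl _ hlv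
  have hv0 : 0 < l v := by linarith
  have hw0 : 0 < l w := by rw [h.l_w]; norm_num
  have hx0 : 0 < l x := by linarith
  have hcard : ({v, -v, w, -w} : Set Plane).ncard = 4 := by
    rw [Set.ncard_insert_of_notMem, Set.ncard_insert_of_notMem, Set.ncard_pair (ne_neg hw0 hw0)]
    · simp only [Set.mem_insert_iff, Set.mem_singleton_iff, not_or]
      exact ⟨(ne_neg hw0 hv0).symm, fun e => hvw (neg_injective e)⟩
    · simp only [Set.mem_insert_iff, Set.mem_singleton_iff, not_or]
      exact ⟨ne_neg hv0 hv0, hvw, ne_neg hv0 hw0⟩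
  have hsub : ({v, -v, w, -w} : Set Plane) ⊆ V := by
    rintro y (rfl | rfl | rfl | hy)
    exacts [h.v_mem, hV.neg_mem _ h.v_mem, h.w_mem,
      Set.mem_singleton_iff.1 hy ▸ hV.neg_mem _ h.w_mem]
  have hfin : (V \ {v, -v, w, -w}).Finite := hV.finite.subset Set.sdiff_subset
  refine ⟨?_, fun y hy => neg_mem_replaceVertex hV hy, ?_⟩
  · refine ⟨(hfin.union (Set.toFinite {x, -x})).toFinset, ?_⟩
    rw [Set.Finite.coe_toFinset, h.replaceVertex_slideTime hV hx]
  · rw [h.extremePoints_replaceVertex_slideTime hV hVe hx, Set.ncard_union_eq ?_ hfin,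
      Set.ncard_pair (ne_neg hx0 hx0), Set.ncard_sdiff hsub, hcard]
    · have := hV.four_lt
      omega
    · rw [Set.disjoint_left]
      rintro y ⟨hy, -⟩ (rfl | hy')
      · exact hxV hy
      · rw [Set.mem_singleton_iff.1 hy'] at hy
        exact hxV (by simpa using hV.neg_mem _ hy)

end IsSlideConfig

/-! ### Conclusion -/

theorem IsSymmetricPolygon.convexHull_extremePoints {S : Set Plane} {k : ℕ}
    (hS : IsSymmetricPolygon S k) :
    (S.extremePoints ℝ).Finite ∧ convexHull ℝ (S.extremePoints ℝ) = S := by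
  obtain ⟨F, hF⟩ := hS.1
  have hfin : (S.extremePoints ℝ).Finite :=
    F.finite_toSet.subset (by rw [hF]; exact extremePoints_convexHull_subset)
  have hcomp : IsCompact S := hF ▸ F.finite_toSet.isCompact_convexHull ℝ
  have hconv : Convex ℝ S := hF ▸ convex_convexHull ℝ _
  refine ⟨hfin, ?_⟩
  rw [← (hfin.isClosed_convexHull ℝ).closure_eq]
  exact closure_convexHull_extremePoints hcomp hconv

theorem IsSymmetricPolygon.isSymmVertexSet {S : Set Plane} {k : ℕ} (hk : 4 < k)
    (hS : IsSymmetricPolygon S k) : IsSymmVertexSet (S.extremePoints ℝ) := by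
  obtain ⟨hfin, hhull⟩ := hS.convexHull_extremePoints
  have hconv : Convex ℝ S := hhull ▸ convex_convexHull ℝ _
  refine ⟨hfin, fun x hx => neg_mem_extremePoints hS.2.1 hx, fun x hx h => ?_, by rwa [hS.2.2]⟩
  exact (hconv.mem_extremePoints_iff_mem_sdiff_convexHull_sdiff.1 hx).2
    (convexHull_mono (Set.sdiff_subset_sdiff_left extremePoints_subset) h)

theorem mainTheorem9 (p : ℝ) (hp : 0 < p) (m : ℕ) (hm : 4 < 2 * m) (S : Set Plane)
    (hS : IsSymmetricPolygon S (2 * m)) :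
    ∃ S' : Set Plane, IsSymmetricPolygon S' (2 * m - 2) ∧ IsMahlerSliding S S' ∧
      lpMahlerVolume p S' ≤ lpMahlerVolume p S := by
  obtain ⟨hfin, hhull⟩ := hS.convexHull_extremePoints
  have hV := hS.isSymmVertexSet hm
  have hcard : (S.extremePoints ℝ).ncard = 2 * m := hS.2.2
  have hslide : ∀ v d t, slide S v d t = replaceVertex (S.extremePoints ℝ) v (v + t • d) :=
    fun _ _ _ => rfl
  have hcomp : IsCompact S := hhull ▸ hfin.isCompact_convexHull ℝ
  obtain ⟨u, v, w, l, α, β, k₁, k₂, h, h₁, h₂⟩ := hV.exists_isSlideConfig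
  set V := S.extremePoints ℝ with hVdef
  have hVe : (convexHull ℝ V).extremePoints ℝ = V := by rw [hhull]
  have package : ∀ {u w : Plane} {α β k₁ k₂ : Plane →ₗ[ℝ] ℝ}, IsSlideConfig V u v w l α β →
      IsEdgeFunctional V k₁ u v → IsEdgeFunctional V k₂ w v →
      IsSymmetricPolygon (slide S v (w - u) (IsSlideConfig.slideTime u v α)) (2 * m - 2) ∧
      IsMahlerSliding S (slide S v (w - u) (IsSlideConfig.slideTime u v α)) ∧
      (fun x => x + (IsSlideConfig.slideTime u v α * slideProfile (l v) (l x)) • (w - u)) ⁻¹'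
        slide S v (w - u) (IsSlideConfig.slideTime u v α) = S := by
    intro u w α β k₁ k₂ h h₁ h₂
    have hd : w - u ≠ 0 := fun e => by
      have := h.α_u
      rw [← sub_eq_zero.1 e, h.α_w] at this
      exact lt_irrefl _ this
    have pre : ∀ s, 0 ≤ s → s ≤ IsSlideConfig.slideTime u v α →
        (fun x => x + (s * slideProfile (l v) (l x)) • (w - u)) ⁻¹' slide S v (w - u) s = S := by
      intro s h0 hs
      rw [hslide, h.shear_preimage hV (h.isAdmissible hV h0 hs), hhull]
    refine ⟨?_, ⟨u, v, w, _, fun e => hd (by rw [e, sub_self]), ?_, ?_, fun s hs => ?_, rfl⟩,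
      pre _ h.slideTime_pos.le le_rfl⟩
    · rw [hslide, ← hcard]
      exact h.isSymmetricPolygon_slideTime hV hVe
    · exact hhull ▸ h₁.isEdge
    · exact hhull ▸ h₂.symm.isEdge
    · rw [Set.uIcc_of_le h.slideTime_pos.le] at hs
      have hcont : Continuous fun r => s * slideProfile (l v) r :=
        continuous_const.mul (continuous_slideProfile _)
      conv_rhs => rw [← pre s hs.1 hs.2]
      exact ((measurePreserving_shear hd h.l_sub h.l_u hcont).measure_preimage_emb
        (measurableEmbedding_shear h.l_sub hcont) _).symm
  obtain ⟨P₁, M₁, K₁⟩ := package h h₁ h₂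
  -- Exchanging u and w gives the slide in the direction u - w, which is a negative time for w - u.
  obtain ⟨P₀, M₀, K₀⟩ := package h.symm h₂ h₁
  have hd : w - u ≠ 0 := fun e => by
    have := h.α_u
    rw [← sub_eq_zero.1 e, h.α_w] at this
    exact lt_irrefl _ this
  have K₀' : (fun x => x + (-IsSlideConfig.slideTime w v β * slideProfile (l v) (l x)) • (w - u))
      ⁻¹' slide S v (u - w) (IsSlideConfig.slideTime w v β) = S := by
    convert K₀ using 3
    module
  rcases min_le_iff.1 (min_lpMahlerVolume_le hp hcomp hS.2.1 hd h.l_sub h.l_u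
    (continuous_slideProfile (l v)) (slideProfile_neg (l v)) (neg_lt_zero.2 h.symm.slideTime_pos)
    h.slideTime_pos K₀' K₁) with h' | h'
  · exact ⟨_, P₀, M₀, h'⟩
  · exact ⟨_, P₁, M₁, h'⟩
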